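/- Let $k$ be a field of characteristic zero and $G$ a finite group with unit $e$. Let $A=D^*(G)=k(G){\blacktriangleright\!\!<}kG$ be the quantum codouble, i.e. the Hopf algebra with basis $\delta_s\otimes u$ ($s,u\in G$) and $$(\delta_s\otimes u)(\delta_t\otimes v)=\delta_{s,t}\,\delta_s\otimes uv,\quad \Delta(\delta_s\otimes u)=\sum_{ab=s}\delta_a\otimes bub^{-1}\otimes\delta_b\otimes u,\quad \varepsilon(\delta_s\otimes u)=\delta_{s,e},\quad S(\delta_s\otimes u)=\delta_{s^{-1}}\otimes su^{-1}s^{-1};$$ let $H$ be the dual Hopf algebra with dual basis $t\otimes\delta_v$, $$(s\otimes\delta_u)(t\otimes\delta_v)=\delta_{u,tvt^{-1}}\,st\otimes\delta_v,\quad \Delta(s\otimes\delta_u)=\sum_{xy=u}s\otimes\delta_x\otimes s\otimes\delta_y,\quad \varepsilon(s\otimes\delta_u)=\delta_{u,e},$$ and let $H^+=\ker\varepsilon$. A quantum tangent space is a subspace $L\subset H^+$ stable under $h\triangleleft a=\sum h_{(1)}\langle h_{(2)},a\rangle-\langle a,h\rangle 1$ ($a\in A$) and under the right adjoint action $g\triangleleft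 h=\sum S(h_{(1)})\,g\,h_{(2)}$ ($h\in H$). It is irreducible if it is nonzero and contains no quantum tangent space other than $0$ and itself. It defines $\Lambda^1=L^*$, with the adjoint right action of $A$ and left action $\triangleright$ of $H$ (equivalently a right coaction of $A$), and $\Omega^1(A)=A\otimes\Lambda^1$ with $$a\cdot(b\otimes x)=ab\otimes x,\quad (b\otimes x)\cdot a=\sum ba_{(1)}\otimes x\triangleleft a_{(2)},\quad {\rm d}a=\sum a_{(1)}\otimes\Pi_{\Lambda^1}(a_{(2)}-\varepsilon(a_{(2)})),$$ where $\Pi_{\Lambda^1}:A^+=\ker\varepsilon\to\Lambda^1$ is adjoint to $L\subset H^+$; the left coaction on $\Omega^1(A)$ is by the coproduct of $A$, the right one is the tensor product of those on $A$ and $\Lambda^1$. The braiding on $\Lambda^1\otimes\Lambda^1$ is $\Psi(x\otimes y)=\sum_i\beta^i\triangleright y\otimes x\triangleleft\alpha_i$ for dual bases $(\alpha_i)$ of $A$ and $(\beta^i)$ of $H$. Let $X=G\rtimes G$ be the semidirect product for the conjugation action, with elements $u.s$ and product $(u.s)(v.t)=usvs^{-1}.st$; we write $u$ for $u.e$. Let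 $X$ act on $kX$ from the right by $v.t\,\tilde\triangleleft\,u.s=s^{-1}vus.s^{-1}ts$, and let $\Pi:kX\to H^+$, $\Pi(v.t)=t\otimes\delta_v-\delta_{v,e}1$. Let $t_0\in G$, $t_0\neq e$, let $C=\{s_0,\dots,s_N\}$ be the conjugacy class of $t_0^{-1}$ in $G$, and fix $\bar s_i\in G$ with $s_i=\bar s_i^{-1}t_0^{-1}\bar s_i$. Put $$z_{ij}=s_is_j^{-1}.s_j\in X,\quad \bar z_{ij}=\bar s_i\bar s_j^{-1}.\bar s_j,\quad m_0=\sum_{v\in{\rm cent}(t_0)}v.t_0,\quad f_{z_{ij}}=m_0\,\tilde\triangleleft\,\bar z_{ij},\quad \mathcal M=\sum_{i,j}k f_{z_{ij}}.$$ Then the $z_{ij}$ are distinct and are exactly the elements of the conjugacy class of $e.t_0^{-1}$ in $X$. The subspace $L=\Pi(\mathcal M)$ is an irreducible quantum tangent space with basis $(\Pi(f_{z_{ij}}))$, and $\Omega^1(A)$, ${\rm d}$ as above form a bicovariant differential calculus on $D^*(G)$ of dimension $\dim\Lambda^1=|C|^2$. Let $(e_{z_{ij}})$ be the basis of $\Lambda^1$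 dual to $(\Pi(f_{z_{ij}}))$, and $R_i(f)(g)=f(gs_i^{-1})$, $\partial_i=R_i-{\rm id}$. For all $f\in k(G)$, $u\in G$ and all $i,j,l,m$: (i) $e_{z_{ij}}f=R_j(f)\,e_{z_{ij}}$ and $e_{z_{ij}}u=(s_j^{-1}us_j)\,e_{u^{-1}z_{ij}u}$. (ii) ${\rm d}f=\sum_i\partial_i(f)\,e_{z_{ii}}$ and ${\rm d}u=\sum_i(s_i^{-1}us_i)\,e_{u^{-1}z_{ii}u}-\sum_iu\,e_{z_{ii}}$. (iii) The calculus is inner: for $\theta=\sum_ie_{z_{ii}}$, ${\rm d}a=\theta a-a\theta$ for all $a\in A$. (iv) $\Psi(e_{z_{ij}}\otimes e_{z_{lm}})=e_{(e.s_j)^{-1}z_{lm}(e.s_j)}\otimes e_{w^{-1}z_{ij}w}$, where $w=s_m^{-1}s_l.e$. -/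

import Mathlib

open scoped TensorProduct

noncomputable section

namespace QuantumCodouble

theorem basis_induction {k V ι : Type*} [Field k] [AddCommGroup V] [Module k V]
    (b : Module.Basis ι k V) {P : V → Prop} (hb : ∀ i, P (b i)) (h0 : P 0)
    (hadd : ∀ x y, P x → P y → P (x + y)) (hsmul : ∀ (c : k) x, P x → P (c • x)) (x : V) :
    P x := by
  have hx : x ∈ Submodule.span k (Set.range b) := by rw [b.span_eq]; trivial
  induction hx using Submodule.span_induction with
  | mem x h => obtain ⟨i, rfl⟩ := h; exact hb i
  | zero => exact h0
  | add x y _ _ hx hy => exact hadd x y hx hy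
  | smul c x _ hx => exact hsmul c x hx

theorem mul_assoc_of_basis {k V ι : Type*} [Field k] [AddCommGroup V] [Module k V]
    (b : Module.Basis ι k V) (μ : V →ₗ[k] V →ₗ[k] V)
    (h : ∀ i j l, μ (μ (b i) (b j)) (b l) = μ (b i) (μ (b j) (b l))) (x y z : V) :
    μ (μ x y) z = μ x (μ y z) := by
  induction x using basis_induction b with
  | h0 => simp
  | hadd x y hx hy => simp [hx, hy]
  | hsmul c x hx => simp [hx]
  | hb i =>
    induction y using basis_induction b with
    | h0 => simp
    | hadd x y hx hy => simp [hx, hy]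
    | hsmul c x hx => simp [hx]
    | hb j =>
      induction z using basis_induction b with
      | h0 => simp
      | hadd x y hx hy => simp [hx, hy]
      | hsmul c x hx => simp [hx]
      | hb l => exact h i j l

theorem mul_hom_of_basis {k V W ι : Type*} [Field k] [Ring V] [Algebra k V] [Ring W] [Algebra k W]
    (b : Module.Basis ι k V) (φ : V →ₗ[k] W)
    (h : ∀ i j, φ (b i * b j) = φ (b i) * φ (b j)) (x y : V) : φ (x * y) = φ x * φ y := by
  induction x using basis_induction b with
  | h0 => simp
  | hadd x y hx hy => simp [add_mul, hx, hy]
  | hsmul c x hx => simp [hx]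
  | hb i =>
    induction y using basis_induction b with
    | h0 => simp
    | hadd x y hx hy => simp [mul_add, hx, hy]
    | hsmul c x hx => simp [hx]
    | hb j => exact h i j

/-! ### The quantum codouble `A = D^*(G) = k(G) ▶< kG`

This is the bicrossproduct of `k(G)` and `kG` for the matched pair `s ▷ u = s u s⁻¹`,
`s ◁ u = s`. -/

/-- The underlying vector space of `D^*(G)`, with basis `δ_s ⊗ u` indexed by the pairs `(s, u)`. -/
def Codouble (k G : Type*) [Field k] : Type _ := G × G →₀ k

namespace Codouble

variable (k G : Type*) [Field k]

instance : AddCommGroup (Codouble k G) := inferInstanceAs (AddCommGroup (G × G →₀ k))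

instance : Module k (Codouble k G) := inferInstanceAs (Module k (G × G →₀ k))

/-- The basis `δ_s ⊗ u`. -/
def basis : Module.Basis (G × G) k (Codouble k G) :=
  ⟨LinearEquiv.refl k (G × G →₀ k)⟩

variable [Group G] [DecidableEq G]

/-- `(δ_s ⊗ u)(δ_t ⊗ v) = δ_{s,t} δ_s ⊗ uv`. -/
def mulMap : Codouble k G →ₗ[k] Codouble k G →ₗ[k] Codouble k G :=
  (basis k G).constr k fun p => (basis k G).constr k fun q =>
    if p.1 = q.1 then basis k G (p.1, p.2 * q.2) else 0

theorem mulMap_basis (p q : G × G) :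
    mulMap k G (basis k G p) (basis k G q) =
      if p.1 = q.1 then basis k G (p.1, p.2 * q.2) else 0 := by
  rw [mulMap, Module.Basis.constr_basis, Module.Basis.constr_basis]

variable [Fintype G]

/-- `1 = ∑_s δ_s ⊗ e`. -/
def unit : Codouble k G := ∑ s : G, basis k G (s, 1)

theorem unit_mul (x : Codouble k G) : mulMap k G (unit k G) x = x := by
  have : mulMap k G (unit k G) = LinearMap.id := by
    refine (basis k G).ext fun p => ?_
    simp [unit, map_sum, LinearMap.sum_apply, mulMap_basis]
  rw [this]; rfl

theorem mul_unit (x : Codouble k G) : mulMap k G x (unit k G) = x := by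
  have : (mulMap k G).flip (unit k G) = LinearMap.id := by
    refine (basis k G).ext fun p => ?_
    simp [unit, map_sum, mulMap_basis]
  exact LinearMap.congr_fun this x

instance : Ring (Codouble k G) :=
  { (inferInstance : AddCommGroup (Codouble k G)) with
    mul := fun x y => mulMap k G x y
    one := unit k G
    left_distrib := fun x y z => map_add (mulMap k G x) y z
    right_distrib := fun x y z => LinearMap.map_add₂ (mulMap k G) x y z
    zero_mul := fun x => LinearMap.map_zero₂ (mulMap k G) x
    mul_zero := fun x => map_zero (mulMap k G x)
    one_mul := unit_mul k G
    mul_one := mul_unit k G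
    mul_assoc := mul_assoc_of_basis (basis k G) (mulMap k G) fun p q r => by
      simp only [mulMap_basis]
      split_ifs with h1 h2 h2 <;> simp_all [mulMap_basis, mul_assoc] }

instance : Algebra k (Codouble k G) :=
  Algebra.ofModule (fun c x y => LinearMap.map_smul₂ (mulMap k G) c x y)
    (fun c x y => map_smul (mulMap k G x) c y)

theorem basis_mul (p q : G × G) :
    basis k G p * basis k G q = if p.1 = q.1 then basis k G (p.1, p.2 * q.2) else 0 :=
  mulMap_basis k G p q

theorem one_eq : (1 : Codouble k G) = ∑ s : G, basis k G (s, 1) := rfl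

/-- `Δ(δ_s ⊗ u) = ∑_{ab=s} δ_a ⊗ (b ▷ u) ⊗ δ_b ⊗ u` and `ε(δ_s ⊗ u) = δ_{s,e}`. -/
instance : CoalgebraStruct k (Codouble k G) where
  comul := (basis k G).constr k fun p => ∑ a : G,
    basis k G (a, (a⁻¹ * p.1) * p.2 * (a⁻¹ * p.1)⁻¹) ⊗ₜ[k] basis k G (a⁻¹ * p.1, p.2)
  counit := (basis k G).constr k fun p => if p.1 = 1 then 1 else 0

theorem comul_basis (p : G × G) : Coalgebra.comul (R := k) (basis k G p) = ∑ a : G,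
    basis k G (a, (a⁻¹ * p.1) * p.2 * (a⁻¹ * p.1)⁻¹) ⊗ₜ[k] basis k G (a⁻¹ * p.1, p.2) :=
  Module.Basis.constr_basis _ _ _ _

theorem counit_basis (p : G × G) :
    Coalgebra.counit (R := k) (basis k G p) = if p.1 = 1 then 1 else 0 :=
  Module.Basis.constr_basis _ _ _ _

instance : Coalgebra k (Codouble k G) where
  coassoc := by
    refine (basis k G).ext fun p => ?_
    simp only [LinearMap.comp_apply, comul_basis, map_sum, LinearMap.rTensor_tmul,
      LinearMap.lTensor_tmul, TensorProduct.sum_tmul, TensorProduct.tmul_sum, LinearEquiv.coe_coe,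
      TensorProduct.assoc_tmul]
    rw [Finset.sum_comm]
    refine Finset.sum_congr rfl fun a _ => ?_
    refine Fintype.sum_equiv (Equiv.mulLeft a⁻¹) _ _ fun b => ?_
    simp [mul_assoc]
  rTensor_counit_comp_comul := by
    refine (basis k G).ext fun p => ?_
    simp [comul_basis, counit_basis, TensorProduct.ite_tmul]
  lTensor_counit_comp_comul := by
    refine (basis k G).ext fun p => ?_
    simp only [LinearMap.comp_apply, comul_basis, map_sum, LinearMap.lTensor_tmul, counit_basis,
      TensorProduct.tmul_ite]
    rw [Finset.sum_eq_single p.1]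
    · simp
    · intro a _ ha
      rw [if_neg]
      intro h
      exact ha (inv_mul_eq_one.mp h)
    · simp

instance : Bialgebra k (Codouble k G) :=
  Bialgebra.mk' k (Codouble k G)
    (by simp [one_eq, counit_basis])
    (by
      intro x y
      refine mul_hom_of_basis (basis k G) (Coalgebra.counit (R := k)) (fun p q => ?_) x y
      rw [basis_mul]
      split_ifs with h
      · simp only [counit_basis, h]; split_ifs <;> simp
      · simp only [counit_basis, map_zero]
        split_ifs with h1 h2 <;> simp_all)
    (by
      simp only [one_eq, map_sum, comul_basis, Algebra.TensorProduct.one_def,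
        TensorProduct.sum_tmul, TensorProduct.tmul_sum]
      rw [Finset.sum_comm]
      conv_rhs => rw [Finset.sum_comm]
      refine Finset.sum_congr rfl fun a _ => ?_
      refine Fintype.sum_equiv (Equiv.mulLeft a⁻¹) _ _ fun b => ?_
      simp)
    (by
      intro x y
      refine mul_hom_of_basis (basis k G) (Coalgebra.comul (R := k)) (fun p q => ?_) x y
      simp only [comul_basis, Finset.sum_mul_sum, Algebra.TensorProduct.tmul_mul_tmul, basis_mul]
      have : ∀ a b : G, ((if a = b then basis k G (a, a⁻¹ * p.1 * p.2 * (a⁻¹ * p.1)⁻¹ *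
          (b⁻¹ * q.1 * q.2 * (b⁻¹ * q.1)⁻¹)) else 0) ⊗ₜ[k]
          (if a⁻¹ * p.1 = b⁻¹ * q.1 then basis k G (a⁻¹ * p.1, p.2 * q.2) else 0)) =
          if a = b then (if p.1 = q.1 then
          basis k G (a, a⁻¹ * p.1 * (p.2 * q.2) * (a⁻¹ * p.1)⁻¹) ⊗ₜ[k]
            basis k G (a⁻¹ * p.1, p.2 * q.2) else 0) else 0 := by
        intro a b
        by_cases h : a = b
        · subst h
          by_cases h' : p.1 = q.1
          · rw [← h']; simp [mul_assoc]
          · simp [h']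
        · simp [h]
      simp only [this, Finset.sum_ite_eq, Finset.mem_univ, if_true]
      split_ifs with h
      · rw [comul_basis]
      · simp)

/-- `S(δ_s ⊗ u) = δ_{(s ◁ u)⁻¹} ⊗ (s ▷ u)⁻¹`. -/
instance : HopfAlgebraStruct k (Codouble k G) where
  antipode := (basis k G).constr k fun p => basis k G (p.1⁻¹, (p.1 * p.2 * p.1⁻¹)⁻¹)

theorem antipode_basis (p : G × G) : HopfAlgebraStruct.antipode k (basis k G p) =
    basis k G (p.1⁻¹, (p.1 * p.2 * p.1⁻¹)⁻¹) :=
  Module.Basis.constr_basis _ _ _ _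

instance : HopfAlgebra k (Codouble k G) where
  mul_antipode_rTensor_comul := by
    refine (basis k G).ext fun p => ?_
    simp only [LinearMap.comp_apply, comul_basis, map_sum, LinearMap.rTensor_tmul, antipode_basis,
      LinearMap.mul'_apply, basis_mul, counit_basis, Algebra.linearMap_apply]
    by_cases h : p.1 = 1
    · simp only [h, if_true, map_one, one_eq]
      refine Fintype.sum_equiv (Equiv.inv G) _ _ fun a => ?_
      simp [mul_assoc]
    · simp [h]
  mul_antipode_lTensor_comul := by
    refine (basis k G).ext fun p => ?_
    simp only [LinearMap.comp_apply, comul_basis, map_sum, LinearMap.lTensor_tmul, antipode_basis,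
      LinearMap.mul'_apply, basis_mul, counit_basis, Algebra.linearMap_apply]
    by_cases h : p.1 = 1
    · simp only [h, if_true, map_one, one_eq]
      refine Finset.sum_congr rfl fun a _ => ?_
      simp [mul_assoc]
    · have : ∀ a : G, a ≠ (a⁻¹ * p.1)⁻¹ := by
        intro a ha
        apply h
        simpa using congrArg (fun x => x⁻¹) ha
      simp only [this, h, if_false, Finset.sum_const_zero, map_zero]

/-- The inclusion `k(G) ⊆ D^*(G)`, `f ↦ ∑_g f(g) δ_g ⊗ e`. -/
def ofFun (f : G → k) : Codouble k G := ∑ g : G, f g • basis k G (g, 1)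

/-- The inclusion `G ⊆ kG ⊆ D^*(G)`, `u ↦ ∑_s δ_s ⊗ u`. -/
def ofGroup (u : G) : Codouble k G := ∑ s : G, basis k G (s, u)

end Codouble

/-! ### The dual Hopf algebra `H = kG ▷◀ k(G)` -/

/-- The underlying vector space of `H`, with basis `t ⊗ δ_v` indexed by the pairs `(t, v)`. -/
def Double (k G : Type*) [Field k] : Type _ := G × G →₀ k

namespace Double

variable (k G : Type*) [Field k]

instance : AddCommGroup (Double k G) := inferInstanceAs (AddCommGroup (G × G →₀ k))

instance : Module k (Double k G) := inferInstanceAs (Module k (G × G →₀ k))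

/-- The basis `t ⊗ δ_v`. -/
def basis : Module.Basis (G × G) k (Double k G) :=
  ⟨LinearEquiv.refl k (G × G →₀ k)⟩

variable [Group G] [DecidableEq G]

/-- `(s ⊗ δ_u)(t ⊗ δ_v) = δ_{u, t ▷ v} st ⊗ δ_v`. -/
def mulMap : Double k G →ₗ[k] Double k G →ₗ[k] Double k G :=
  (basis k G).constr k fun p => (basis k G).constr k fun q =>
    if p.2 = q.1 * q.2 * q.1⁻¹ then basis k G (p.1 * q.1, q.2) else 0

theorem mulMap_basis (p q : G × G) :
    mulMap k G (basis k G p) (basis k G q) =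
      if p.2 = q.1 * q.2 * q.1⁻¹ then basis k G (p.1 * q.1, q.2) else 0 := by
  rw [mulMap, Module.Basis.constr_basis, Module.Basis.constr_basis]

variable [Fintype G]

/-- `1 = ∑_u e ⊗ δ_u`. -/
def unit : Double k G := ∑ u : G, basis k G (1, u)

theorem unit_mul (x : Double k G) : mulMap k G (unit k G) x = x := by
  have : mulMap k G (unit k G) = LinearMap.id := by
    refine (basis k G).ext fun p => ?_
    simp [unit, map_sum, LinearMap.sum_apply, mulMap_basis]
  rw [this]; rfl

theorem mul_unit (x : Double k G) : mulMap k G x (unit k G) = x := by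
  have : (mulMap k G).flip (unit k G) = LinearMap.id := by
    refine (basis k G).ext fun p => ?_
    simp [unit, map_sum, mulMap_basis]
  exact LinearMap.congr_fun this x

instance : Ring (Double k G) :=
  { (inferInstance : AddCommGroup (Double k G)) with
    mul := fun x y => mulMap k G x y
    one := unit k G
    left_distrib := fun x y z => map_add (mulMap k G x) y z
    right_distrib := fun x y z => LinearMap.map_add₂ (mulMap k G) x y z
    zero_mul := fun x => LinearMap.map_zero₂ (mulMap k G) x
    mul_zero := fun x => map_zero (mulMap k G x)
    one_mul := unit_mul k G
    mul_one := mul_unit k G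
    mul_assoc := mul_assoc_of_basis (basis k G) (mulMap k G) fun p q r => by
      simp only [mulMap_basis]
      split_ifs with h1 h2 h2 <;> simp_all [mulMap_basis, mul_assoc] }

instance : Algebra k (Double k G) :=
  Algebra.ofModule (fun c x y => LinearMap.map_smul₂ (mulMap k G) c x y)
    (fun c x y => map_smul (mulMap k G x) c y)

theorem basis_mul (p q : G × G) : basis k G p * basis k G q =
    if p.2 = q.1 * q.2 * q.1⁻¹ then basis k G (p.1 * q.1, q.2) else 0 :=
  mulMap_basis k G p q

theorem one_eq : (1 : Double k G) = ∑ u : G, basis k G (1, u) := rfl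

/-- `Δ(s ⊗ δ_u) = ∑_{xy=u} s ⊗ δ_x ⊗ (s ◁ x) ⊗ δ_y` and `ε(s ⊗ δ_u) = δ_{u,e}`. -/
instance : CoalgebraStruct k (Double k G) where
  comul := (basis k G).constr k fun p => ∑ x : G,
    basis k G (p.1, x) ⊗ₜ[k] basis k G (p.1, x⁻¹ * p.2)
  counit := (basis k G).constr k fun p => if p.2 = 1 then 1 else 0

theorem comul_basis (p : G × G) : Coalgebra.comul (R := k) (basis k G p) = ∑ x : G,
    basis k G (p.1, x) ⊗ₜ[k] basis k G (p.1, x⁻¹ * p.2) :=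
  Module.Basis.constr_basis _ _ _ _

theorem counit_basis (p : G × G) :
    Coalgebra.counit (R := k) (basis k G p) = if p.2 = 1 then 1 else 0 :=
  Module.Basis.constr_basis _ _ _ _

instance : Coalgebra k (Double k G) where
  coassoc := by
    refine (basis k G).ext fun p => ?_
    simp only [LinearMap.comp_apply, comul_basis, map_sum, LinearMap.rTensor_tmul,
      LinearMap.lTensor_tmul, TensorProduct.sum_tmul, TensorProduct.tmul_sum, LinearEquiv.coe_coe,
      TensorProduct.assoc_tmul]
    rw [Finset.sum_comm]
    refine Finset.sum_congr rfl fun a _ => ?_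
    refine Fintype.sum_equiv (Equiv.mulLeft a⁻¹) _ _ fun b => ?_
    simp [mul_assoc]
  rTensor_counit_comp_comul := by
    refine (basis k G).ext fun p => ?_
    simp [comul_basis, counit_basis, TensorProduct.ite_tmul]
  lTensor_counit_comp_comul := by
    refine (basis k G).ext fun p => ?_
    simp only [LinearMap.comp_apply, comul_basis, map_sum, LinearMap.lTensor_tmul, counit_basis,
      TensorProduct.tmul_ite]
    rw [Finset.sum_eq_single p.2]
    · simp
    · intro a _ ha
      rw [if_neg]
      intro h
      exact ha (inv_mul_eq_one.mp h)
    · simp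

instance : Bialgebra k (Double k G) :=
  Bialgebra.mk' k (Double k G)
    (by simp [one_eq, counit_basis])
    (by
      intro x y
      refine mul_hom_of_basis (basis k G) (Coalgebra.counit (R := k)) (fun p q => ?_) x y
      rw [basis_mul]
      split_ifs with h
      · simp only [counit_basis, h]
        by_cases h' : q.2 = 1 <;> simp [h']
      · simp only [counit_basis, map_zero]
        split_ifs with h1 h2 <;> simp_all)
    (by
      simp only [one_eq, map_sum, comul_basis, Algebra.TensorProduct.one_def,
        TensorProduct.sum_tmul, TensorProduct.tmul_sum]
      rw [Finset.sum_comm]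
      conv_rhs => rw [Finset.sum_comm]
      refine Finset.sum_congr rfl fun a _ => ?_
      refine Fintype.sum_equiv (Equiv.mulLeft a⁻¹) _ _ fun b => ?_
      simp)
    (by
      intro x y
      refine mul_hom_of_basis (basis k G) (Coalgebra.comul (R := k)) (fun p q => ?_) x y
      simp only [comul_basis, Finset.sum_mul_sum, Algebra.TensorProduct.tmul_mul_tmul, basis_mul]
      rw [Finset.sum_comm]
      have : ∀ b a : G, ((if a = q.1 * b * q.1⁻¹ then basis k G (p.1 * q.1, b) else 0) ⊗ₜ[k]
          (if a⁻¹ * p.2 = q.1 * (b⁻¹ * q.2) * q.1⁻¹ then basis k G (p.1 * q.1, b⁻¹ * q.2) else 0)) =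
          if a = q.1 * b * q.1⁻¹ then (if p.2 = q.1 * q.2 * q.1⁻¹ then
          basis k G (p.1 * q.1, b) ⊗ₜ[k] basis k G (p.1 * q.1, b⁻¹ * q.2) else 0) else 0 := by
        intro b a
        by_cases h : a = q.1 * b * q.1⁻¹
        · subst h
          by_cases h' : p.2 = q.1 * q.2 * q.1⁻¹
          · rw [h']; simp [mul_assoc]
          · have h2 : ¬ ((q.1 * b * q.1⁻¹)⁻¹ * p.2 = q.1 * (b⁻¹ * q.2) * q.1⁻¹) := by
              intro h3
              apply h'
              have := congrArg (fun x => q.1 * b * q.1⁻¹ * x) h3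
              simpa [mul_assoc] using this
            rw [if_neg h', if_neg h2]; simp
        · simp [h]
      simp only [this, Finset.sum_ite_eq', Finset.mem_univ, if_true]
      split_ifs with h
      · rw [comul_basis]
      · simp)

/-- `S(s ⊗ δ_u) = (s ◁ u)⁻¹ ⊗ δ_{(s ▷ u)⁻¹}`. -/
instance : HopfAlgebraStruct k (Double k G) where
  antipode := (basis k G).constr k fun p => basis k G (p.1⁻¹, (p.1 * p.2 * p.1⁻¹)⁻¹)

theorem antipode_basis (p : G × G) : HopfAlgebraStruct.antipode k (basis k G p) =
    basis k G (p.1⁻¹, (p.1 * p.2 * p.1⁻¹)⁻¹) :=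
  Module.Basis.constr_basis _ _ _ _

instance : HopfAlgebra k (Double k G) where
  mul_antipode_rTensor_comul := by
    refine (basis k G).ext fun p => ?_
    simp only [LinearMap.comp_apply, comul_basis, map_sum, LinearMap.rTensor_tmul, antipode_basis,
      LinearMap.mul'_apply, basis_mul, counit_basis, Algebra.linearMap_apply]
    by_cases h : p.2 = 1
    · simp only [h, if_true, map_one, one_eq]
      refine Fintype.sum_equiv (Equiv.inv G) _ _ fun a => ?_
      simp [mul_assoc]
    · have : ∀ a : G, ¬ ((p.1 * a * p.1⁻¹)⁻¹ = p.1 * (a⁻¹ * p.2) * p.1⁻¹) := by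
        intro a ha
        apply h
        have := congrArg (fun x => a * p.1⁻¹ * x * p.1) ha
        simpa [mul_assoc] using this.symm
      simp only [this, h, if_false, Finset.sum_const_zero, map_zero]
  mul_antipode_lTensor_comul := by
    refine (basis k G).ext fun p => ?_
    simp only [LinearMap.comp_apply, comul_basis, map_sum, LinearMap.lTensor_tmul, antipode_basis,
      LinearMap.mul'_apply, basis_mul, counit_basis, Algebra.linearMap_apply]
    by_cases h : p.2 = 1
    · simp only [h, if_true, map_one, one_eq]
      refine Fintype.sum_equiv (MulAut.conj p.1).toEquiv _ _ fun a => ?_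
      simp [mul_assoc]
    · have : ∀ a : G, ¬ (a = p.1⁻¹ * (p.1 * (a⁻¹ * p.2) * p.1⁻¹)⁻¹ * p.1⁻¹⁻¹) := by
        intro a ha
        apply h
        have h2 := congrArg (fun x => x⁻¹) ha
        simpa [mul_assoc] using h2
      simp only [this, h, if_false, Finset.sum_const_zero, map_zero]

end Double

/-! ### Bicovariant differential calculi -/

section Calculus

open TensorProduct Coalgebra

variable {k A Ω : Type*} [Field k] [Ring A] [AddCommGroup Ω] [Module k Ω]

/-- `(Ω, d)` is a first order differential calculus over the algebra `A`; `lm` and `rm` are the left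
and right multiplications of 1-forms by elements of `A`. -/
structure IsDifferentialCalculus [Algebra k A] (lm : A ⊗[k] Ω →ₗ[k] Ω) (rm : Ω ⊗[k] A →ₗ[k] Ω)
    (d : A →ₗ[k] Ω) : Prop where
  one_left : ∀ ω, lm (1 ⊗ₜ ω) = ω
  mul_left : ∀ a b ω, lm ((a * b) ⊗ₜ ω) = lm (a ⊗ₜ lm (b ⊗ₜ ω))
  one_right : ∀ ω, rm (ω ⊗ₜ 1) = ω
  mul_right : ∀ ω a b, rm (ω ⊗ₜ (a * b)) = rm (rm (ω ⊗ₜ a) ⊗ₜ b)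
  left_right : ∀ a ω b, rm (lm (a ⊗ₜ ω) ⊗ₜ b) = lm (a ⊗ₜ rm (ω ⊗ₜ b))
  leibniz : ∀ a b, d (a * b) = lm (a ⊗ₜ d b) + rm (d a ⊗ₜ b)
  surjective : Function.Surjective (lm ∘ₗ d.lTensor A)

/-- `(Ω, d)` is a bicovariant differential calculus over the Hopf algebra `A`: moreover `Ω` is a
bicomodule under `ΔL`, `ΔR`, these are bimodule maps, and `d` is a bicomodule map. -/
structure IsBicovariantCalculus [HopfAlgebra k A] (lm : A ⊗[k] Ω →ₗ[k] Ω)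
    (rm : Ω ⊗[k] A →ₗ[k] Ω) (d : A →ₗ[k] Ω) (ΔL : Ω →ₗ[k] A ⊗[k] Ω) (ΔR : Ω →ₗ[k] Ω ⊗[k] A) :
    Prop extends IsDifferentialCalculus lm rm d where
  coassoc_left : (TensorProduct.assoc k A A Ω).toLinearMap ∘ₗ (comul (R := k)).rTensor Ω ∘ₗ ΔL =
    ΔL.lTensor A ∘ₗ ΔL
  counit_left : ∀ ω, TensorProduct.lid k Ω ((counit (R := k) (A := A)).rTensor Ω (ΔL ω)) = ω
  coassoc_right : (TensorProduct.assoc k Ω A A).toLinearMap ∘ₗ ΔR.rTensor A ∘ₗ ΔR =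
    (comul (R := k)).lTensor Ω ∘ₗ ΔR
  counit_right : ∀ ω, TensorProduct.rid k Ω ((counit (R := k) (A := A)).lTensor Ω (ΔR ω)) = ω
  left_right_comm : (TensorProduct.assoc k A Ω A).toLinearMap ∘ₗ ΔL.rTensor A ∘ₗ ΔR =
    ΔR.lTensor A ∘ₗ ΔL
  left_coact_left_mul : ΔL ∘ₗ lm = map (LinearMap.mul' k A) lm ∘ₗ
    (tensorTensorTensorComm k A A A Ω).toLinearMap ∘ₗ map (comul (R := k)) ΔL
  left_coact_right_mul : ΔL ∘ₗ rm = map (LinearMap.mul' k A) rm ∘ₗ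
    (tensorTensorTensorComm k A Ω A A).toLinearMap ∘ₗ map ΔL (comul (R := k))
  right_coact_left_mul : ΔR ∘ₗ lm = map lm (LinearMap.mul' k A) ∘ₗ
    (tensorTensorTensorComm k A A Ω A).toLinearMap ∘ₗ map (comul (R := k)) ΔR
  right_coact_right_mul : ΔR ∘ₗ rm = map rm (LinearMap.mul' k A) ∘ₗ
    (tensorTensorTensorComm k Ω A A A).toLinearMap ∘ₗ map ΔR (comul (R := k))
  left_coact_d : ΔL ∘ₗ d = d.lTensor A ∘ₗ comul (R := k)
  right_coact_d : ΔR ∘ₗ d = d.rTensor A ∘ₗ comul (R := k)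

end Calculus

/-! ### Quantum tangent spaces and the calculi they define -/

section TangentSpace

open TensorProduct Coalgebra

variable (k G : Type*) [Field k] [Group G] [Fintype G] [DecidableEq G]

/-- The pairing `⟨δ_s ⊗ u, t ⊗ δ_v⟩ = δ_{s,t} δ_{u,v}`, which makes `H` the dual of `A`. -/
def pairing : Codouble k G →ₗ[k] Double k G →ₗ[k] k :=
  (Codouble.basis k G).constr k fun p => (Double.basis k G).coord p

/-- The action `h ◁ a = ∑ h₍₁₎ ⟨h₍₂₎, a⟩ - ⟨a, h⟩ 1` of `A`, to be used on `H⁺ = ker ε`. -/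
def coregular : Codouble k G →ₗ[k] Double k G →ₗ[k] Double k G :=
  LinearMap.mk₂ k (fun a h =>
      TensorProduct.rid k (Double k G) ((pairing k G a).lTensor (Double k G) (comul (R := k) h)) -
        pairing k G a h • (1 : Double k G))
    (fun a b h => by simp [LinearMap.lTensor_add, add_smul]; abel)
    (fun c a h => by simp [LinearMap.lTensor_smul, smul_sub, mul_smul])
    (fun a g h => by simp [add_smul]; abel)
    (fun c a h => by simp [smul_sub, mul_smul])

/-- The right quantum adjoint action `g ◁ h = ∑ S(h₍₁₎) g h₍₂₎`; the first argument is `h`. -/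
def adjoint : Double k G →ₗ[k] Double k G →ₗ[k] Double k G :=
  LinearMap.mk₂ k (fun h g =>
      LinearMap.mul' k (Double k G)
        (((LinearMap.mul k (Double k G)).flip g ∘ₗ HopfAlgebraStruct.antipode k).rTensor
          (Double k G) (comul (R := k) h)))
    (fun h h' g => by simp)
    (fun c h g => by simp)
    (fun h g g' => by simp [LinearMap.add_comp, LinearMap.rTensor_add])
    (fun c h g => by simp [LinearMap.smul_comp, LinearMap.rTensor_smul])

/-- A quantum tangent space of `A`: a subspace of `H⁺` stable under the two actions that make up the
canonical action of `D(H)` on `H⁺`. -/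
structure QuantumTangentSpace where
  carrier : Submodule k (Double k G)
  le_ker_counit : carrier ≤ LinearMap.ker (counit (R := k) (A := Double k G))
  coregular_mem : ∀ a, ∀ l ∈ carrier, coregular k G a l ∈ carrier
  adjoint_mem : ∀ h, ∀ l ∈ carrier, adjoint k G h l ∈ carrier

namespace QuantumTangentSpace

variable {k G} (L : QuantumTangentSpace k G)

/-- `L` is an irreducible `D(H)`-submodule of `H⁺`. -/
def IsIrreducible : Prop :=
  L.carrier ≠ ⊥ ∧ ∀ L' : QuantumTangentSpace k G,
    L'.carrier ≤ L.carrier → L'.carrier = ⊥ ∨ L'.carrier = L.carrier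

/-- The invariant 1-forms `Λ¹ = L^*`. -/
abbrev InvForms : Type _ := Module.Dual k L.carrier

/-- The right action of `A` on `Λ¹`, adjoint to the action of `A` on `L`. -/
def rightAct : L.InvForms →ₗ[k] Codouble k G →ₗ[k] L.InvForms :=
  LinearMap.mk₂ k (fun x a => x ∘ₗ (coregular k G a).restrict (L.coregular_mem a))
    (fun x y a => by ext l; simp)
    (fun c x a => by ext l; simp)
    (fun x a b => by
      ext l
      simp only [LinearMap.comp_apply, LinearMap.add_apply, ← map_add]
      congr 1
      ext : 1
      simp [LinearMap.restrict_apply])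
    (fun c x a => by
      ext l
      simp only [LinearMap.comp_apply, LinearMap.smul_apply, ← map_smul]
      congr 1
      ext : 1
      simp [LinearMap.restrict_apply])

/-- The left action of `H` on `Λ¹`, adjoint to the right adjoint action of `H` on `L`. -/
def leftAct : Double k G →ₗ[k] L.InvForms →ₗ[k] L.InvForms :=
  LinearMap.mk₂ k (fun h x => x ∘ₗ (adjoint k G h).restrict (L.adjoint_mem h))
    (fun g h x => by
      ext l
      simp only [LinearMap.comp_apply, LinearMap.add_apply, ← map_add]
      congr 1
      ext : 1
      simp [LinearMap.restrict_apply])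
    (fun c h x => by
      ext l
      simp only [LinearMap.comp_apply, LinearMap.smul_apply, ← map_smul]
      congr 1
      ext : 1
      simp [LinearMap.restrict_apply])
    (fun h x y => by ext l; simp)
    (fun c h x => by ext l; simp)

/-- The right coaction of `A` on `Λ¹` equivalent to the left action of `H`:
`x ↦ ∑_i (β^i ▷ x) ⊗ α_i` for dual bases `(α_i)` of `A` and `(β^i)` of `H`. -/
def coact : L.InvForms →ₗ[k] L.InvForms ⊗[k] Codouble k G :=
  ∑ p : G × G, (TensorProduct.mk k L.InvForms (Codouble k G)).flip (Codouble.basis k G p) ∘ₗ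
    L.leftAct (Double.basis k G p)

/-- The braiding `Ψ(x ⊗ y) = ∑_i (β^i ▷ y) ⊗ (x ◁ α_i)` on `Λ¹ ⊗ Λ¹`. -/
def braiding : L.InvForms ⊗[k] L.InvForms →ₗ[k] L.InvForms ⊗[k] L.InvForms :=
  ∑ p : G × G, map (L.leftAct (Double.basis k G p)) (L.rightAct.flip (Codouble.basis k G p)) ∘ₗ
    (TensorProduct.comm k L.InvForms L.InvForms).toLinearMap

/-- The 1-forms `Ω¹(A) = A ⊗ Λ¹`. -/
abbrev OneForms : Type _ := Codouble k G ⊗[k] L.InvForms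

/-- An invariant 1-form as a 1-form. -/
def form (x : L.InvForms) : L.OneForms := 1 ⊗ₜ x

/-- `a ⬝ (b ⊗ x) = ab ⊗ x`. -/
def leftMul : Codouble k G ⊗[k] L.OneForms →ₗ[k] L.OneForms :=
  (LinearMap.mul' k (Codouble k G)).rTensor L.InvForms ∘ₗ
    (TensorProduct.assoc k (Codouble k G) (Codouble k G) L.InvForms).symm.toLinearMap

/-- `(b ⊗ x) ⬝ a = ∑ b a₍₁₎ ⊗ (x ◁ a₍₂₎)`. -/
def rightMul : L.OneForms ⊗[k] Codouble k G →ₗ[k] L.OneForms :=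
  map (LinearMap.mul' k (Codouble k G)) (TensorProduct.lift L.rightAct) ∘ₗ
    (tensorTensorTensorComm k (Codouble k G) L.InvForms (Codouble k G)
      (Codouble k G)).toLinearMap ∘ₗ
    (comul (R := k)).lTensor L.OneForms

/-- `a ↦ Π_{Λ¹}(a - ε(a))`, where `Π_{Λ¹} : A⁺ → Λ¹` is adjoint to the inclusion `L ⊆ H⁺`. -/
def proj : Codouble k G →ₗ[k] L.InvForms :=
  LinearMap.lcomp k k L.carrier.subtype ∘ₗ pairing k G ∘ₗ
    (LinearMap.id - Algebra.linearMap k (Codouble k G) ∘ₗ counit (R := k))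

/-- `d a = ∑ a₍₁₎ ⊗ Π_{Λ¹}(a₍₂₎ - ε(a₍₂₎))`. -/
def d : Codouble k G →ₗ[k] L.OneForms :=
  L.proj.lTensor (Codouble k G) ∘ₗ comul (R := k)

/-- The left coaction of `A` on `Ω¹`, given by the coproduct of `A`. -/
def leftCoact : L.OneForms →ₗ[k] Codouble k G ⊗[k] L.OneForms :=
  (TensorProduct.assoc k (Codouble k G) (Codouble k G) L.InvForms).toLinearMap ∘ₗ
    (comul (R := k)).rTensor L.InvForms

/-- The right coaction of `A` on `Ω¹`, the tensor product of those on `A` and on `Λ¹`. -/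
def rightCoact : L.OneForms →ₗ[k] L.OneForms ⊗[k] Codouble k G :=
  (LinearMap.mul' k (Codouble k G)).lTensor L.OneForms ∘ₗ
    (tensorTensorTensorComm k (Codouble k G) (Codouble k G) L.InvForms
      (Codouble k G)).toLinearMap ∘ₗ
    map (comul (R := k)) L.coact

end QuantumTangentSpace

end TangentSpace

/-! ### The data attached to a conjugacy class of `G` -/

section Canonical

variable {G : Type*} [Group G]

/-- The group `X = G ⋊ G` for the action by conjugation. Its element `u.s` is `⟨u, s⟩`. -/
abbrev X (G : Type*) [Group G] : Type _ := G ⋊[MulAut.conj] G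

/-- The conjugacy class of `t₀⁻¹` in `G`; its elements are the `s_i`. -/
abbrev ClassG (t₀ : G) : Type _ := {s : G // IsConj t₀⁻¹ s}

/-- The conjugacy class of `e.t₀⁻¹` in `X`. -/
abbrev ClassX (t₀ : G) : Type _ :=
  {x : X G // IsConj (SemidirectProduct.inr t₀⁻¹ : X G) x}

/-- `z_{ij} = s_i s_j⁻¹ . s_j`. -/
def z {t₀ : G} (i j : ClassG t₀) : ClassX t₀ :=
  ⟨⟨(i : G) * (j : G)⁻¹, j⟩, by
    obtain ⟨c, hc⟩ := isConj_iff.mp i.2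
    obtain ⟨d, hd⟩ := isConj_iff.mp j.2
    refine isConj_iff.mpr ⟨⟨c * d⁻¹, d⟩, ?_⟩
    ext
    · simp [← hc, ← hd, mul_assoc]
    · simp [← hd]⟩

/-- `x⁻¹ z x`. -/
def conj {t₀ : G} (w : ClassX t₀) (x : X G) : ClassX t₀ :=
  ⟨x⁻¹ * w * x, w.2.trans (isConj_iff.mpr ⟨x⁻¹, by simp⟩)⟩

/-- For elements `s̄_i` of `G` with `s_i = s̄_i⁻¹ t₀⁻¹ s̄_i`, the element
`s̄_i s̄_j⁻¹ . s̄_j` of `X`, which conjugates `t₀⁻¹` to `z_{ij}`. -/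
def zbar {t₀ : G} (sbar : ClassG t₀ → G) (i j : ClassG t₀) : X G :=
  ⟨sbar i * (sbar j)⁻¹, sbar j⟩

variable (k : Type*) [Field k]

/-- The right action `vt ◁~ us = (s⁻¹ ▷ vu).(s⁻¹ t s)` of `us ∈ X` on the vector space `kX`. -/
def crossedAct (x : X G) : (X G →₀ k) →ₗ[k] (X G →₀ k) :=
  Finsupp.lmapDomain k k fun y =>
    (⟨x.right⁻¹ * (y.left * x.left) * x.right, x.right⁻¹ * y.right * x.right⟩ : X G)

variable [Fintype G] [DecidableEq G]

/-- `Π : kX → H⁺`, `vt ↦ t ⊗ δ_v - ε(t ⊗ δ_v) 1`. -/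
def toTangent : (X G →₀ k) →ₗ[k] Double k G :=
  (LinearMap.id - Algebra.linearMap k (Double k G) ∘ₗ Coalgebra.counit (R := k)) ∘ₗ
    Finsupp.linearCombination k fun y : X G => Double.basis k G (y.right, y.left)

/-- `m₀ = ∑_{v ∈ cent(t₀)} v.t₀`. -/
def m₀ (t₀ : G) : X G →₀ k :=
  ∑ v : G with v * t₀ = t₀ * v, Finsupp.single (⟨v, t₀⟩ : X G) 1

/-- `𝓜 = ∑_{i,j} (k m₀) ◁~ z̄_{ij}`. -/
def tangentModule {t₀ : G} (sbar : ClassG t₀ → G) : Submodule k (X G →₀ k) :=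
  ⨆ (i : ClassG t₀) (j : ClassG t₀),
    (Submodule.span k {m₀ k t₀}).map (crossedAct k (zbar sbar i j))

variable {k}

/-- `R_i(f)(g) = f(g s_i⁻¹)`. -/
def translate (s : G) (f : G → k) : G → k := fun g => f (g * s⁻¹)

end Canonical

end QuantumCodouble

end

open QuantumCodouble

noncomputable section

namespace QuantumCodouble

/-! The map `v.s ↦ (vs, s)` is an isomorphism from `X` to `G × G`. It sends `z i j` to `(s_i, s_j)`
and `e.t₀⁻¹` to `(t₀⁻¹, t₀⁻¹)`, so the conjugacy class in `X` is `C × C`. Conjugation by `u.e` moves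
the first index only, conjugation by `e.s` moves both.

Everything else is computed on vectors indexed by `C × C`. By `toTangent_crossedAct_m₀`, the image
of `f_{z_{ij}}` is the sum of `Π(w.s_j⁻¹)` over all `w` that conjugate `s_i` to `s_j`; the choice of
the `s̄_i` drops out. On these vectors `δ_s ⊗ u` vanishes unless `s = s_j⁻¹`, and then conjugates
the first index by `u`; `s ⊗ δ_u` vanishes unless `u = s⁻¹ s_j⁻¹ s_i s`, and then conjugates both
indices by `s⁻¹` (`coregular_tangentVector`, `adjoint_tangentVector`). So the span is stable. The
actions contain the projections onto the basis lines and permute these lines transitively, whence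
irreducibility. The transposed actions on `Λ¹` are again partial permutations of a basis
(`rightAct_formBasis`, `leftAct_formBasis`), and the commutation relations and the braiding are read
off from them.

The calculus rests on `proj_eq`: `Π_{Λ¹}(a - ε(a)) = θ ◁ a - ε(a) θ` for `θ = ∑ e_{z_{ii}}`.
Combined with the coproduct it gives `d a = θ a - a θ` (`d_eq`). The Leibniz rule is then formal,
and bicovariance of `d` follows from that of the two multiplications because `θ` is coinvariant on
both sides. That 1-forms are generated by differentials comes from `s_j ≠ e`, which lets a left
multiplication isolate one term of `d(δ_t ⊗ v)`. -/

/-- The element `s ↦ u s u⁻¹` of the conjugacy class. -/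
def conjBy {G : Type*} [Group G] {t₀ : G} (u : G) (s : ClassG t₀) : ClassG t₀ :=
  ⟨u * s * u⁻¹, s.2.trans (isConj_iff.mpr ⟨u, rfl⟩)⟩

/-! ### The conjugacy class in `X` as a product of two copies of the class in `G`. -/

section ClassG

variable {G : Type*} [Group G] {t₀ : G}

@[simp]
theorem coe_conjBy (u : G) (s : ClassG t₀) : (conjBy u s : G) = u * s * u⁻¹ := rfl

@[simp]
theorem conjBy_one (s : ClassG t₀) : conjBy 1 s = s := by ext; simp

@[simp]
theorem conjBy_conjBy (u v : G) (s : ClassG t₀) : conjBy u (conjBy v s) = conjBy (u * v) s := by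
  ext; simp [mul_assoc]

theorem conjBy_eq_iff (u : G) (s t : ClassG t₀) : conjBy u s = t ↔ s = conjBy u⁻¹ t := by
  constructor <;> rintro rfl <;> simp

theorem conjBy_injective (u : G) : Function.Injective (conjBy u : ClassG t₀ → ClassG t₀) :=
  fun s t h => by simpa using congrArg (conjBy u⁻¹) h

theorem exists_conjBy_eq (s t : ClassG t₀) : ∃ u : G, conjBy u s = t := by
  obtain ⟨c, hc⟩ := isConj_iff.mp (s.2.symm.trans t.2)
  exact ⟨c, Subtype.ext hc⟩

/-- This is how `t₀ ≠ 1` enters: it separates the tangent vectors from the correction by `1`, and it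
isolates terms of `d`. -/
theorem coe_ne_one (ht₀ : t₀ ≠ 1) (s : ClassG t₀) : (s : G) ≠ 1 := by
  obtain ⟨c, hc⟩ := isConj_iff.mp s.2
  rw [← hc]
  intro h
  apply ht₀
  simpa using h

/-- The two coordinates `vs` and `s` of `v.s` recover `s_i` and `s_j`. -/
theorem z_injective : Function.Injective (fun p : ClassG t₀ × ClassG t₀ => z p.1 p.2) := by
  rintro ⟨i, j⟩ ⟨l, m⟩ h
  have h2 := congrArg (fun w : ClassX t₀ => (w : X G).right) h
  have h1 := congrArg (fun w : ClassX t₀ => (w : X G).left * (w : X G).right) h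
  simp only [z, inv_mul_cancel_right] at h1 h2
  exact Prod.ext (Subtype.ext h1) (Subtype.ext h2)

theorem z_surjective : Function.Surjective (fun p : ClassG t₀ × ClassG t₀ => z p.1 p.2) := by
  rintro ⟨w, hw⟩
  obtain ⟨c, rfl⟩ := isConj_iff.mp hw
  -- In `G × G` the conjugator `c` becomes `(c.left * c.right, c.right)`, acting on `(t₀⁻¹, t₀⁻¹)`
  -- componentwise.
  refine ⟨(⟨(c.left * c.right) * t₀⁻¹ * (c.left * c.right)⁻¹, isConj_iff.mpr ⟨_, rfl⟩⟩,
    ⟨c.right * t₀⁻¹ * c.right⁻¹, isConj_iff.mpr ⟨_, rfl⟩⟩), ?_⟩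
  ext <;> simp [z, mul_assoc]

theorem z_bijective : Function.Bijective (fun p : ClassG t₀ × ClassG t₀ => z p.1 p.2) :=
  ⟨z_injective, z_surjective⟩

/-- Under `X ≅ G × G` the element `inl u` is `(u, 1)`, whereas `inr u` in the next lemma is `(u,
u)`. -/
theorem conj_z_inl (i j : ClassG t₀) (u : G) :
    conj (z i j) (SemidirectProduct.inl u) = z (conjBy u⁻¹ i) j := by
  ext <;> simp [conj, z, mul_assoc]

theorem conj_z_inr (i j : ClassG t₀) (u : G) :
    conj (z i j) (SemidirectProduct.inr u) = z (conjBy u⁻¹ i) (conjBy u⁻¹ j) := by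
  ext <;> simp [conj, z, mul_assoc]

end ClassG

/-! ### The two actions on `H⁺` and the vectors spanning the tangent space. -/

section Tangent

variable {k G : Type*} [Field k] [Group G] [Fintype G] [DecidableEq G]

theorem pairing_basis (p q : G × G) :
    pairing k G (Codouble.basis k G p) (Double.basis k G q) = if p = q then 1 else 0 := by
  rw [pairing, Module.Basis.constr_basis, Module.Basis.coord_apply, Module.Basis.repr_self,
    Finsupp.single_apply]
  simp only [eq_comm]

theorem coregular_basis (s u t v : G) :
    coregular k G (Codouble.basis k G (s, u)) (Double.basis k G (t, v)) =
      if s = t then Double.basis k G (t, v * u⁻¹) - (if u = v then 1 else 0) else 0 := by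
  have h : ∀ x : G, u = x⁻¹ * v ↔ x = v * u⁻¹ := fun x => by
    rw [eq_inv_mul_iff_mul_eq, eq_mul_inv_iff_mul_eq]
  by_cases hst : s = t
  · simp [coregular, Double.comul_basis, pairing_basis, hst, h, ite_smul]
  · simp [coregular, Double.comul_basis, pairing_basis, hst]

theorem coregular_one (a : Codouble k G) : coregular k G a 1 = 0 := by
  simp [coregular, Algebra.TensorProduct.one_def]

/-- In `∑ S(h₍₁₎) g h₍₂₎` the first product is nonzero for exactly one summation index `x`; the
second product then forces the value of `u`. -/
theorem adjoint_basis (s u t v : G) :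
    adjoint k G (Double.basis k G (s, u)) (Double.basis k G (t, v)) =
      if u = s⁻¹ * t * v⁻¹ * t⁻¹ * v * s then
        Double.basis k G (s⁻¹ * t * s, s⁻¹ * v * s) else 0 := by
  have h : ∀ x : G, (s * x * s⁻¹)⁻¹ = t * v * t⁻¹ ↔ x = s⁻¹ * t * v⁻¹ * t⁻¹ * s := fun x => by
    constructor
    · intro h
      have := congrArg (fun y => s⁻¹ * y⁻¹ * s) h
      simpa [mul_assoc] using this
    · rintro rfl; simp [mul_assoc]
  simp only [adjoint, LinearMap.mk₂_apply, Double.comul_basis, map_sum, LinearMap.rTensor_tmul,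
    LinearMap.comp_apply, Double.antipode_basis, LinearMap.flip_apply, LinearMap.mul_apply',
    LinearMap.mul'_apply, Double.basis_mul, h, ite_mul, zero_mul, Finset.sum_ite_eq',
    Finset.mem_univ, if_true]
  have h2 : v = s * ((s⁻¹ * t * v⁻¹ * t⁻¹ * s)⁻¹ * u) * s⁻¹ ↔
      u = s⁻¹ * t * v⁻¹ * t⁻¹ * v * s := by
    constructor
    · intro h
      have := congrArg (fun y => s⁻¹ * t * v⁻¹ * t⁻¹ * y * s) h
      simpa [mul_assoc] using this.symm
    · rintro rfl; simp [mul_assoc]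
  rw [if_congr h2 rfl rfl]
  split_ifs with h3
  · subst h3; simp [mul_assoc]
  · rfl

/-- This is the antipode axiom `∑ S(h₍₁₎) h₍₂₎ = ε(h) 1`. -/
theorem adjoint_one (h : Double k G) :
    adjoint k G h 1 = Coalgebra.counit (R := k) h • (1 : Double k G) := by
  have := LinearMap.congr_fun (HopfAlgebra.mul_antipode_rTensor_comul (R := k) (A := Double k G)) h
  simp only [LinearMap.comp_apply, Algebra.linearMap_apply, Algebra.algebraMap_eq_smul_one] at this
  rw [← this, adjoint, LinearMap.mk₂_apply]
  congr 3
  ext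
  simp

variable (k) in
/-- `Π(v.t) = t ⊗ δ_v - δ_{v,e} 1`. -/
def tangentElement (v t : G) : Double k G :=
  Double.basis k G (t, v) - if v = 1 then 1 else 0

theorem toTangent_single (y : X G) :
    toTangent k (Finsupp.single y 1) = tangentElement k y.left y.right := by
  simp only [toTangent, LinearMap.comp_apply, Finsupp.linearCombination_single, one_smul,
    LinearMap.sub_apply, LinearMap.id_apply, Double.counit_basis, tangentElement]
  split_ifs <;> simp

theorem counit_tangentElement (v t : G) :
    Coalgebra.counit (R := k) (tangentElement k v t) = 0 := by
  rw [tangentElement, map_sub, Double.counit_basis]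
  split_ifs <;> simp

/-- The action kills `1`, and the term `⟨a, h⟩ 1` subtracted in its definition is exactly the
correction that `Π` makes when `v * u⁻¹ = 1`. -/
theorem coregular_tangentElement (s u v t : G) :
    coregular k G (Codouble.basis k G (s, u)) (tangentElement k v t) =
      if s = t then tangentElement k (v * u⁻¹) t else 0 := by
  have h : (v * u⁻¹ = 1) ↔ u = v := by rw [mul_inv_eq_one, eq_comm]
  have h' : coregular k G (Codouble.basis k G (s, u)) (if v = 1 then 1 else 0) = 0 := by
    split_ifs <;> simp [coregular_one]
  simp only [tangentElement, map_sub, coregular_basis, h', sub_zero, h]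

theorem adjoint_tangentElement (s u v t : G) :
    adjoint k G (Double.basis k G (s, u)) (tangentElement k v t) =
      if u = s⁻¹ * t * v⁻¹ * t⁻¹ * v * s then
        tangentElement k (s⁻¹ * v * s) (s⁻¹ * t * s) else 0 := by
  by_cases hv : v = 1
  · subst hv
    simp only [tangentElement, map_sub, adjoint_basis, if_true, adjoint_one, Double.counit_basis]
    by_cases hu : u = 1 <;> simp [hu]
  · have : s⁻¹ * v * s ≠ 1 := by
      intro h
      apply hv
      simpa [mul_assoc] using congrArg (fun y => s * y * s⁻¹) h
    simp only [tangentElement, adjoint_basis, if_neg hv, if_neg this, sub_zero]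

variable {t₀ : G}

variable (k) in
/-- The image of `f_{z_{ij}}` in `H⁺`. -/
def tangentVector (p : ClassG t₀ × ClassG t₀) : Double k G :=
  ∑ w : G with conjBy w p.1 = p.2, tangentElement k w (p.2 : G)⁻¹

/-- The elements conjugating `s_i` to `s_j` form the set `s̄_j⁻¹ cent(t₀) s̄_i`, and `v.t₀` is moved
to `(s̄_j⁻¹ v s̄_i).s_j⁻¹`. -/
theorem toTangent_crossedAct_m₀ (sbar : ClassG t₀ → G)
    (hsbar : ∀ i : ClassG t₀, (sbar i)⁻¹ * t₀⁻¹ * sbar i = i) (i j : ClassG t₀) :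
    toTangent k (crossedAct k (zbar sbar i j) (m₀ k t₀)) = tangentVector k (i, j) := by
  simp only [m₀, crossedAct, map_sum, Finsupp.lmapDomain_apply, Finsupp.mapDomain_single,
    toTangent_single, tangentVector]
  refine Finset.sum_bij' (fun v _ => (sbar j)⁻¹ * v * sbar i)
    (fun w _ => sbar j * w * (sbar i)⁻¹) ?_ ?_ ?_ ?_ ?_
  · intro v hv
    simp only [Finset.mem_filter, Finset.mem_univ, true_and] at hv ⊢
    ext
    rw [coe_conjBy, ← hsbar i, ← hsbar j]
    have : v * t₀⁻¹ * v⁻¹ = t₀⁻¹ := by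
      rw [mul_inv_eq_iff_eq_mul, eq_inv_mul_iff_mul_eq, ← mul_assoc, ← hv]; simp
    simp only [mul_assoc, mul_inv_rev, inv_inv, mul_inv_cancel_left] at this ⊢
    simpa [mul_assoc] using congrArg (fun y => (sbar j)⁻¹ * y * sbar j) this
  · intro w hw
    simp only [Finset.mem_filter, Finset.mem_univ, true_and] at hw ⊢
    have h := congrArg (Subtype.val) hw
    rw [coe_conjBy, ← hsbar i, ← hsbar j] at h
    have := congrArg (fun y => sbar j * y⁻¹ * w * (sbar i)⁻¹) h
    simpa [mul_assoc] using this
  · intro v _; simp [mul_assoc]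
  · intro v _; simp [mul_assoc]
  · intro v _
    congr 1
    · simp [zbar, mul_assoc]
    · rw [← hsbar j]; simp [zbar, mul_assoc]

theorem coregular_tangentVector (s u : G) (i j : ClassG t₀) :
    coregular k G (Codouble.basis k G (s, u)) (tangentVector k (i, j)) =
      if s = (j : G)⁻¹ then tangentVector k (conjBy u i, j) else 0 := by
  simp only [tangentVector, map_sum, coregular_tangentElement]
  split_ifs with h
  · refine Finset.sum_bij' (fun w _ => w * u⁻¹) (fun w _ => w * u) ?_ ?_ ?_ ?_ ?_ <;> simp
  · simp

/-- The support condition of `adjoint_tangentElement` involves `s_j⁻¹ w⁻¹ s_j w`, which equals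
`s_j⁻¹ s_i` for every `w` in the sum. Hence all summands survive or vanish together. -/
theorem adjoint_tangentVector (s u : G) (i j : ClassG t₀) :
    adjoint k G (Double.basis k G (s, u)) (tangentVector k (i, j)) =
      if u = s⁻¹ * (j : G)⁻¹ * i * s then
        tangentVector k (conjBy s⁻¹ i, conjBy s⁻¹ j) else 0 := by
  simp only [tangentVector, map_sum, adjoint_tangentElement]
  have key : ∀ w ∈ ({w : G | conjBy w i = j} : Finset G),
      s⁻¹ * (j : G)⁻¹ * w⁻¹ * (j : G)⁻¹⁻¹ * w * s = s⁻¹ * (j : G)⁻¹ * i * s := by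
    intro w hw
    obtain rfl := (Finset.mem_filter.mp hw).2
    simp [mul_assoc]
  rw [Finset.sum_congr rfl fun w hw => by rw [key w hw]]
  split_ifs with h
  · refine Finset.sum_bij' (fun w _ => s⁻¹ * w * s) (fun w _ => s * w * s⁻¹) ?_ ?_ ?_ ?_ ?_
    · intro w hw
      obtain rfl := (Finset.mem_filter.mp hw).2
      simp [mul_assoc]
    · intro w hw
      have h2 := congrArg (conjBy s) (Finset.mem_filter.mp hw).2
      simpa [mul_assoc] using h2
    · intro w _; simp [mul_assoc]
    · intro w _; simp [mul_assoc]
    · intro w _; simp [mul_assoc]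
  · simp

theorem counit_tangentVector (p : ClassG t₀ × ClassG t₀) :
    Coalgebra.counit (R := k) (tangentVector k p) = 0 := by
  simp [tangentVector, counit_tangentElement]

/-- The coefficient of `m⁻¹ ⊗ δ_w` in the image of `f_{z_{ij}}`. -/
theorem coord_tangentVector (ht₀ : t₀ ≠ 1) (w : G) (i j m : ClassG t₀) :
    (Double.basis k G).coord ((m : G)⁻¹, w) (tangentVector k (i, j)) =
      if conjBy w i = j ∧ j = m then 1 else 0 := by
  -- `1 = ∑ e ⊗ δ_u` involves only the first index `e`, which is not the inverse of a class element.
  have h1 : (Double.basis k G).coord ((m : G)⁻¹, w) 1 = 0 := by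
    simp only [Double.one_eq, map_sum, Module.Basis.coord_apply, Module.Basis.repr_self]
    refine Finset.sum_eq_zero fun u _ => Finsupp.single_eq_of_ne ?_
    simp [Prod.ext_iff, coe_ne_one ht₀]
  have h2 : ∀ v : G, (Double.basis k G).coord ((m : G)⁻¹, w) (tangentElement k v (j : G)⁻¹) =
      if v = w ∧ j = m then 1 else 0 := by
    intro v
    have h3 : (Double.basis k G).coord ((m : G)⁻¹, w) (if v = 1 then 1 else 0) = 0 := by
      split_ifs <;> simp only [h1, map_zero]
    rw [tangentElement, map_sub, h3, sub_zero, Module.Basis.coord_apply, Module.Basis.repr_self,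
      Finsupp.single_apply]
    simp [Prod.ext_iff, Subtype.ext_iff, and_comm]
  by_cases hjm : j = m
  · subst hjm
    simp [tangentVector, -Module.Basis.coord_apply, h2, Finset.sum_ite_eq']
  · simp [tangentVector, -Module.Basis.coord_apply, h2, hjm]

/-- A pair `(s_j⁻¹, w)` determines `s_j` and `s_i = w⁻¹ s_j w`, so apart from multiples of `1` the
supports are disjoint. One coordinate from each support gives a dual family. -/
theorem linearIndependent_tangentVector (ht₀ : t₀ ≠ 1) :
    LinearIndependent k (tangentVector k : ClassG t₀ × ClassG t₀ → Double k G) := by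
  choose c hc using fun p : ClassG t₀ × ClassG t₀ => exists_conjBy_eq p.1 p.2
  refine LinearIndependent.of_pairwise_dual_eq_zero_one _
    (fun p => (Double.basis k G).coord ((p.2 : G)⁻¹, c p)) ?_ ?_
  · rintro ⟨i, j⟩ ⟨l, m⟩ h
    rw [coord_tangentVector ht₀, if_neg]
    rintro ⟨h1, rfl⟩
    apply h
    exact Prod.ext (conjBy_injective _ (hc _ |>.trans h1.symm)) rfl
  · rintro ⟨i, j⟩
    rw [coord_tangentVector ht₀, if_pos ⟨hc (i, j), rfl⟩]

end Tangent

/-! ### The tangent space, its dual, and the form `θ`. -/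

section CanonicalCalculus

variable {k G : Type*} [Field k] [Group G] [Fintype G] [DecidableEq G] {t₀ : G}

theorem map_mem_span_of_basis {V W ι κ : Type*} [AddCommGroup V] [Module k V] [AddCommGroup W]
    [Module k W] (b : Module.Basis ι k V) (v : κ → W) (B : V →ₗ[k] W →ₗ[k] W)
    (h : ∀ i j, B (b i) (v j) ∈ Submodule.span k (Set.range v)) (a : V) :
    ∀ l ∈ Submodule.span k (Set.range v), B a l ∈ Submodule.span k (Set.range v) := by
  intro l hl
  induction hl using Submodule.span_induction with
  | mem x hx =>
    obtain ⟨j, rfl⟩ := hx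
    induction a using basis_induction b with
    | hb i => exact h i j
    | h0 => simp
    | hadd x y hx hy => rw [LinearMap.map_add₂]; exact add_mem hx hy
    | hsmul c x hx => rw [LinearMap.map_smul₂]; exact Submodule.smul_mem _ c hx
  | zero => simp
  | add x y _ _ hx hy => rw [map_add]; exact add_mem hx hy
  | smul c x _ hx => rw [map_smul]; exact Submodule.smul_mem _ c hx

variable (k t₀) in
/-- The quantum tangent space spanned by the images of the `f_{z_{ij}}`. -/
def canonicalTangentSpace : QuantumTangentSpace k G where
  carrier := Submodule.span k (Set.range (tangentVector k (t₀ := t₀)))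
  le_ker_counit := by
    rw [Submodule.span_le]
    rintro _ ⟨p, rfl⟩
    exact counit_tangentVector p
  coregular_mem := map_mem_span_of_basis (Codouble.basis k G) _ _ fun ⟨s, u⟩ ⟨i, j⟩ => by
    rw [coregular_tangentVector]
    split_ifs
    · exact Submodule.subset_span ⟨_, rfl⟩
    · exact zero_mem _
  adjoint_mem := map_mem_span_of_basis (Double.basis k G) _ _ fun ⟨s, u⟩ ⟨i, j⟩ => by
    rw [adjoint_tangentVector]
    split_ifs
    · exact Submodule.subset_span ⟨_, rfl⟩
    · exact zero_mem _

theorem map_toTangent_tangentModule (sbar : ClassG t₀ → G)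
    (hsbar : ∀ i : ClassG t₀, (sbar i)⁻¹ * t₀⁻¹ * sbar i = i) :
    (tangentModule k sbar).map (toTangent k) = (canonicalTangentSpace k t₀).carrier := by
  simp only [tangentModule, Submodule.map_iSup, Submodule.map_span, Set.image_singleton,
    toTangent_crossedAct_m₀ sbar hsbar, canonicalTangentSpace, Submodule.span_range_eq_iSup,
    iSup_prod]

variable (k) in
/-- The basis of the canonical quantum tangent space given by the images of the `f_{z_{ij}}`. -/
def tangentBasis (ht₀ : t₀ ≠ 1) :
    Module.Basis (ClassG t₀ × ClassG t₀) k (canonicalTangentSpace k t₀).carrier :=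
  Module.Basis.span (linearIndependent_tangentVector ht₀)

theorem coe_tangentBasis (ht₀ : t₀ ≠ 1) (p : ClassG t₀ × ClassG t₀) :
    (tangentBasis k ht₀ p : Double k G) = tangentVector k p :=
  congrArg Subtype.val (Module.Basis.span_apply (linearIndependent_tangentVector ht₀) p)

variable (k) in
/-- The basis of the invariant 1-forms dual to the basis `tangentBasis`. -/
def formBasis (ht₀ : t₀ ≠ 1) :
    Module.Basis (ClassG t₀ × ClassG t₀) k (canonicalTangentSpace k t₀).InvForms :=
  (tangentBasis k ht₀).dualBasis

theorem formBasis_apply (ht₀ : t₀ ≠ 1) (p q : ClassG t₀ × ClassG t₀) :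
    formBasis k ht₀ p (tangentBasis k ht₀ q) = if p = q then 1 else 0 := by
  rw [formBasis, Module.Basis.dualBasis_apply_self]
  simp only [eq_comm]

/-- Transposing a partial permutation inverts it, whence `u⁻¹` here. The support condition is
unchanged because it involves only the fixed index `j`. -/
theorem rightAct_formBasis (ht₀ : t₀ ≠ 1) (s u : G) (i j : ClassG t₀) :
    (canonicalTangentSpace k t₀).rightAct (formBasis k ht₀ (i, j)) (Codouble.basis k G (s, u)) =
      if s = (j : G)⁻¹ then formBasis k ht₀ (conjBy u⁻¹ i, j) else 0 := by
  refine (tangentBasis k ht₀).ext fun ⟨l, m⟩ => ?_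
  have h : (coregular k G (Codouble.basis k G (s, u))).restrict
      ((canonicalTangentSpace k t₀).coregular_mem _) (tangentBasis k ht₀ (l, m)) =
      if s = (m : G)⁻¹ then tangentBasis k ht₀ (conjBy u l, m) else 0 := by
    ext : 1
    rw [LinearMap.coe_restrict_apply, coe_tangentBasis, coregular_tangentVector]
    split_ifs <;> simp [coe_tangentBasis]
  have h2 : i = conjBy u l ↔ conjBy u⁻¹ i = l := by rw [conjBy_eq_iff, inv_inv]
  simp only [QuantumTangentSpace.rightAct, LinearMap.mk₂_apply, LinearMap.comp_apply, h]
  by_cases hjm : j = m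
  · subst hjm
    split_ifs with h1 <;> simp [formBasis_apply, h2]
  · have h3 : (if s = (j : G)⁻¹ then formBasis k ht₀ (conjBy u⁻¹ i, j) else 0)
        (tangentBasis k ht₀ (l, m)) = 0 := by
      split_ifs <;> simp [formBasis_apply, hjm]
    rw [h3]
    split_ifs <;> simp [formBasis_apply, hjm]

theorem leftAct_formBasis (ht₀ : t₀ ≠ 1) (s u : G) (i j : ClassG t₀) :
    (canonicalTangentSpace k t₀).leftAct (Double.basis k G (s, u)) (formBasis k ht₀ (i, j)) =
      if u = (j : G)⁻¹ * i then formBasis k ht₀ (conjBy s i, conjBy s j) else 0 := by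
  refine (tangentBasis k ht₀).ext fun ⟨l, m⟩ => ?_
  have h : (adjoint k G (Double.basis k G (s, u))).restrict
      ((canonicalTangentSpace k t₀).adjoint_mem _) (tangentBasis k ht₀ (l, m)) =
      if u = s⁻¹ * (m : G)⁻¹ * l * s then
        tangentBasis k ht₀ (conjBy s⁻¹ l, conjBy s⁻¹ m) else 0 := by
    ext : 1
    rw [LinearMap.coe_restrict_apply, coe_tangentBasis, adjoint_tangentVector]
    split_ifs <;> simp [coe_tangentBasis]
  simp only [QuantumTangentSpace.leftAct, LinearMap.mk₂_apply, LinearMap.comp_apply, h]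
  by_cases hl : conjBy s i = l ∧ conjBy s j = m
  · obtain ⟨rfl, rfl⟩ := hl
    -- The support condition, written for the image pair, becomes one on the original pair.
    have : s⁻¹ * (conjBy s j : G)⁻¹ * conjBy s i * s = (j : G)⁻¹ * i := by simp [mul_assoc]
    rw [this]
    split_ifs <;> simp [formBasis_apply]
  · have h2 : ¬ (i = conjBy s⁻¹ l ∧ j = conjBy s⁻¹ m) := by
      rwa [← conjBy_eq_iff, ← conjBy_eq_iff]
    have h3 : (if u = (j : G)⁻¹ * i then formBasis k ht₀ (conjBy s i, conjBy s j) else 0)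
        (tangentBasis k ht₀ (l, m)) = 0 := by
      split_ifs <;> simp [formBasis_apply, Prod.ext_iff, hl]
    rw [h3]
    split_ifs <;> simp [formBasis_apply, Prod.ext_iff, h2]

variable (k) in
/-- The invariant 1-form `θ = ∑_i e_{z_{ii}}`. -/
def theta (ht₀ : t₀ ≠ 1) : (canonicalTangentSpace k t₀).InvForms :=
  ∑ i : ClassG t₀, formBasis k ht₀ (i, i)

theorem pairing_one_left (h : Double k G) :
    pairing k G 1 h = Coalgebra.counit (R := k) h := by
  have : pairing k G 1 = Coalgebra.counit (R := k) := by
    refine (Double.basis k G).ext fun q => ?_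
    simp [Codouble.one_eq, pairing_basis, Double.counit_basis, Prod.ext_iff, ite_and, eq_comm]
  rw [this]

/-- The second term is the correction by `1`: it occurs only for `w = e`, which is among the
summands exactly when `i = j`. -/
theorem pairing_tangentVector (s u : G) (i j : ClassG t₀) :
    pairing k G (Codouble.basis k G (s, u)) (tangentVector k (i, j)) =
      (if s = (j : G)⁻¹ ∧ conjBy u i = j then 1 else 0) - if s = 1 ∧ i = j then 1 else 0 := by
  have h1 : pairing k G (Codouble.basis k G (s, u)) 1 = if s = 1 then 1 else 0 := by
    simp [Double.one_eq, pairing_basis, Prod.ext_iff, ite_and]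
  have h2 : ∀ w, pairing k G (Codouble.basis k G (s, u)) (tangentElement k w (j : G)⁻¹) =
      (if s = (j : G)⁻¹ ∧ u = w then 1 else 0) - if w = 1 ∧ s = 1 then 1 else 0 := by
    intro w
    have h3 : pairing k G (Codouble.basis k G (s, u)) (if w = 1 then 1 else 0) =
        if w = 1 ∧ s = 1 then 1 else 0 := by
      by_cases hw : w = 1
      · simp only [hw, if_true, true_and, h1]
      · simp only [hw, if_false, false_and, map_zero]
    rw [tangentElement, map_sub, pairing_basis, h3]
    simp only [Prod.mk.injEq]
  rw [tangentVector, map_sum, Finset.sum_congr rfl fun w _ => h2 w, Finset.sum_sub_distrib]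
  congr 1
  · by_cases hs : s = (j : G)⁻¹ <;> simp [hs]
  · by_cases hs : s = 1 <;> simp [hs]

/-- `θ` takes the value `1` on the diagonal basis vectors and `0` on the others. So `θ ◁ (δ_s ⊗ u)`
tests whether `s = s_m⁻¹` and `u` conjugates `s_l` to `s_m`, which is the first term of
`pairing_tangentVector`. -/
theorem proj_eq (ht₀ : t₀ ≠ 1) (a : Codouble k G) :
    (canonicalTangentSpace k t₀).proj a =
      (canonicalTangentSpace k t₀).rightAct (theta k ht₀) a -
        Coalgebra.counit (R := k) a • theta k ht₀ := by
  induction a using basis_induction (Codouble.basis k G) with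
  | h0 => simp
  | hadd x y hx hy => simp only [map_add, hx, hy, add_smul]; abel
  | hsmul c x hx => simp only [map_smul, hx, smul_sub, mul_smul, smul_eq_mul]
  | hb p =>
    obtain ⟨s, u⟩ := p
    refine (tangentBasis k ht₀).ext fun ⟨l, m⟩ => ?_
    have h1 : ∀ i : ClassG t₀, (if s = (i : G)⁻¹ then formBasis k ht₀ (conjBy u⁻¹ i, i) else 0)
        (tangentBasis k ht₀ (l, m)) =
        if i = m then (if s = (m : G)⁻¹ ∧ conjBy u l = m then 1 else 0) else 0 := by
      intro i
      by_cases him : i = m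
      · subst him
        have : conjBy u l = i ↔ conjBy u⁻¹ i = l := by rw [conjBy_eq_iff, eq_comm]
        simp only [this, if_true]
        by_cases hs : s = (i : G)⁻¹ <;> simp [hs, formBasis_apply]
      · split_ifs <;> simp [formBasis_apply, him]
    have h2 : ∀ i : ClassG t₀, formBasis k ht₀ (i, i) (tangentBasis k ht₀ (l, m)) =
        if i = m then (if l = m then 1 else 0) else 0 := by
      intro i
      rw [formBasis_apply]
      by_cases him : i = m
      · subst him; simp [eq_comm]
      · simp [him]
    simp only [QuantumTangentSpace.proj, theta, map_sum, LinearMap.sum_apply, rightAct_formBasis,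
      LinearMap.sub_apply, LinearMap.comp_apply, LinearMap.lcomp_apply, Submodule.subtype_apply,
      coe_tangentBasis, map_sub, LinearMap.id_apply, Algebra.linearMap_apply,
      Algebra.algebraMap_eq_smul_one, map_smul, pairing_tangentVector, LinearMap.smul_apply,
      pairing_one_left, counit_tangentVector, Codouble.counit_basis, h1, h2, Finset.sum_ite_eq',
      Finset.mem_univ, if_true, smul_zero, sub_zero]
    by_cases hs : s = 1 <;> simp [hs]

end CanonicalCalculus

/-! ### Bimodule, coactions and differential in terms of bases. -/

section CanonicalCalculus

variable {k G : Type*} [Field k] [Group G] [Fintype G] [DecidableEq G] {t₀ : G}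

open TensorProduct Coalgebra

section General

variable (L : QuantumTangentSpace k G)

theorem leftMul_tmul (a b : Codouble k G) (x : L.InvForms) :
    L.leftMul (a ⊗ₜ (b ⊗ₜ x)) = (a * b) ⊗ₜ x := rfl

theorem leftMul_form (a : Codouble k G) (x : L.InvForms) :
    L.leftMul (a ⊗ₜ L.form x) = a ⊗ₜ x := by
  rw [QuantumTangentSpace.form, leftMul_tmul, mul_one]

theorem form_sum {ι : Type*} (s : Finset ι) (x : ι → L.InvForms) :
    L.form (∑ i ∈ s, x i) = ∑ i ∈ s, L.form (x i) :=
  tmul_sum _ _ _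

theorem rightMul_form (x : L.InvForms) (a : Codouble k G) :
    L.rightMul (L.form x ⊗ₜ a) = (L.rightAct x).lTensor (Codouble k G) (comul (R := k) a) := by
  simp only [QuantumTangentSpace.rightMul, QuantumTangentSpace.form, LinearMap.comp_apply,
    LinearMap.lTensor_tmul]
  induction comul (R := k) a using TensorProduct.induction_on with
  | zero => simp
  | tmul b c => simp [tensorTensorTensorComm_tmul]
  | add y z hy hz => rw [tmul_add, map_add, map_add, hy, hz, map_add]

theorem leftMul_mul (a b : Codouble k G) (ω : L.OneForms) :
    L.leftMul ((a * b) ⊗ₜ ω) = L.leftMul (a ⊗ₜ L.leftMul (b ⊗ₜ ω)) := by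
  induction ω using TensorProduct.induction_on with
  | zero => simp
  | tmul c x => simp only [leftMul_tmul, mul_assoc]
  | add y z hy hz => simp only [tmul_add, map_add, hy, hz]

theorem rightMul_leftMul (a : Codouble k G) (ω : L.OneForms) (b : Codouble k G) :
    L.rightMul (L.leftMul (a ⊗ₜ ω) ⊗ₜ b) = L.leftMul (a ⊗ₜ L.rightMul (ω ⊗ₜ b)) := by
  induction ω using TensorProduct.induction_on with
  | zero => simp
  | tmul c x =>
    simp only [leftMul_tmul, QuantumTangentSpace.rightMul, LinearMap.comp_apply,
      LinearMap.lTensor_tmul]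
    induction comul (R := k) b using TensorProduct.induction_on with
    | zero => simp
    | tmul b c => simp [tensorTensorTensorComm_tmul, leftMul_tmul, mul_assoc]
    | add y z hy hz => simp only [tmul_add, map_add, hy, hz]
  | add y z hy hz => simp only [tmul_add, add_tmul, map_add, hy, hz]

end General

/-- Indexing the sum by the second leg lets the condition `s = s_j⁻¹` of `rightAct_formBasis`
collapse it at once. -/
theorem comul_basis_mk (s u : G) : comul (R := k) (Codouble.basis k G (s, u)) = ∑ a : G,
    Codouble.basis k G (s * a⁻¹, a * u * a⁻¹) ⊗ₜ[k] Codouble.basis k G (a, u) := by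
  rw [Codouble.comul_basis]
  refine Fintype.sum_equiv ((Equiv.inv G).trans (Equiv.mulRight s)) _ _ fun a => ?_
  simp

theorem rightMul_basis (ht₀ : t₀ ≠ 1) (b : Codouble k G) (i j : ClassG t₀) (t v : G) :
    (canonicalTangentSpace k t₀).rightMul
      ((b ⊗ₜ formBasis k ht₀ (i, j)) ⊗ₜ Codouble.basis k G (t, v)) =
      (b * Codouble.basis k G (t * j, (j : G)⁻¹ * v * j)) ⊗ₜ
        formBasis k ht₀ (conjBy v⁻¹ i, j) := by
  simp only [QuantumTangentSpace.rightMul, LinearMap.comp_apply, LinearMap.lTensor_tmul,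
    comul_basis_mk, tmul_sum, map_sum, LinearEquiv.coe_coe, tensorTensorTensorComm_tmul, map_tmul,
    LinearMap.mul'_apply, lift.tmul, rightAct_formBasis, tmul_ite, Finset.sum_ite_eq',
    Finset.mem_univ, if_true, inv_inv]

theorem coact_formBasis (ht₀ : t₀ ≠ 1) (i j : ClassG t₀) :
    (canonicalTangentSpace k t₀).coact (formBasis k ht₀ (i, j)) =
      ∑ s : G, formBasis k ht₀ (conjBy s i, conjBy s j) ⊗ₜ
        Codouble.basis k G (s, (j : G)⁻¹ * i) := by
  simp only [QuantumTangentSpace.coact, LinearMap.sum_apply, LinearMap.comp_apply,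
    Fintype.sum_prod_type, leftAct_formBasis, LinearMap.flip_apply, mk_apply, ite_tmul,
    Finset.sum_ite_eq', Finset.mem_univ, if_true]

theorem rightCoact_basis (ht₀ : t₀ ≠ 1) (s u : G) (i j : ClassG t₀) :
    (canonicalTangentSpace k t₀).rightCoact
      (Codouble.basis k G (s, u) ⊗ₜ formBasis k ht₀ (i, j)) =
      ∑ r : G, (Codouble.basis k G (s * r⁻¹, r * u * r⁻¹) ⊗ₜ
        formBasis k ht₀ (conjBy r i, conjBy r j)) ⊗ₜ Codouble.basis k G (r, u * (j : G)⁻¹ * i) := by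
  simp only [QuantumTangentSpace.rightCoact, LinearMap.comp_apply, map_tmul, comul_basis_mk,
    coact_formBasis, tmul_sum, sum_tmul, map_sum, LinearEquiv.coe_coe, tensorTensorTensorComm_tmul,
    LinearMap.lTensor_tmul, LinearMap.mul'_apply, Codouble.basis_mul, tmul_ite,
    Finset.sum_ite_eq', Finset.mem_univ, if_true, mul_assoc]

theorem leftCoact_basis (L : QuantumTangentSpace k G) (s u : G) (x : L.InvForms) :
    L.leftCoact (Codouble.basis k G (s, u) ⊗ₜ x) =
      ∑ a : G, Codouble.basis k G (s * a⁻¹, a * u * a⁻¹) ⊗ₜ (Codouble.basis k G (a, u) ⊗ₜ x) := by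
  simp only [QuantumTangentSpace.leftCoact, LinearMap.comp_apply, LinearMap.rTensor_tmul,
    comul_basis_mk, sum_tmul, map_sum, LinearEquiv.coe_coe, assoc_tmul]

/-- Insert `proj_eq` in the second leg of the coproduct: the action term is right multiplication of
`θ`, and the counit axiom turns the other into `a θ`. -/
theorem d_eq (ht₀ : t₀ ≠ 1) (a : Codouble k G) :
    (canonicalTangentSpace k t₀).d a =
      (canonicalTangentSpace k t₀).rightMul
        ((canonicalTangentSpace k t₀).form (theta k ht₀) ⊗ₜ a) -
      (canonicalTangentSpace k t₀).leftMul
        (a ⊗ₜ (canonicalTangentSpace k t₀).form (theta k ht₀)) := by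
  have h : (canonicalTangentSpace k t₀).proj =
      (canonicalTangentSpace k t₀).rightAct (theta k ht₀) -
        LinearMap.toSpanSingleton k _ (theta k ht₀) ∘ₗ counit (R := k) := by
    ext1 a
    rw [proj_eq ht₀]
    rfl
  rw [rightMul_form, leftMul_form, QuantumTangentSpace.d, h, LinearMap.lTensor_sub,
    LinearMap.sub_comp, LinearMap.sub_apply, LinearMap.comp_apply, LinearMap.comp_apply,
    LinearMap.lTensor_comp_apply, Coalgebra.lTensor_counit_comul, LinearMap.lTensor_tmul,
    LinearMap.toSpanSingleton_apply, one_smul]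

theorem d_basis (ht₀ : t₀ ≠ 1) (t v : G) :
    (canonicalTangentSpace k t₀).d (Codouble.basis k G (t, v)) =
      ∑ i : ClassG t₀, Codouble.basis k G (t * i, (i : G)⁻¹ * v * i) ⊗ₜ
        formBasis k ht₀ (conjBy v⁻¹ i, i) -
      ∑ i : ClassG t₀, Codouble.basis k G (t, v) ⊗ₜ formBasis k ht₀ (i, i) := by
  simp only [d_eq ht₀, leftMul_form]
  simp only [theta, QuantumTangentSpace.form, tmul_sum, sum_tmul, map_sum, rightMul_basis, one_mul]

variable (k) in
/-- The basis of the 1-forms made from `Codouble.basis` and `formBasis`. -/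
def oneFormsBasis (ht₀ : t₀ ≠ 1) :
    Module.Basis ((G × G) × ClassG t₀ × ClassG t₀) k (canonicalTangentSpace k t₀).OneForms :=
  (Codouble.basis k G).tensorProduct (formBasis k ht₀)

theorem oneFormsBasis_apply (ht₀ : t₀ ≠ 1) (s u : G) (i j : ClassG t₀) :
    oneFormsBasis k ht₀ ((s, u), (i, j)) =
      Codouble.basis k G (s, u) ⊗ₜ formBasis k ht₀ (i, j) :=
  Module.Basis.tensorProduct_apply _ _ _ _

theorem rightMul_one (ht₀ : t₀ ≠ 1) (ω : (canonicalTangentSpace k t₀).OneForms) :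
    (canonicalTangentSpace k t₀).rightMul (ω ⊗ₜ 1) = ω := by
  induction ω using basis_induction (oneFormsBasis k ht₀) with
  | h0 => simp
  | hadd x y hx hy => rw [add_tmul, map_add, hx, hy]
  | hsmul c x hx => rw [← smul_tmul', map_smul, hx]
  | hb p =>
    obtain ⟨⟨s, u⟩, i, j⟩ := p
    rw [oneFormsBasis_apply, Codouble.one_eq]
    simp only [tmul_sum, map_sum, rightMul_basis, Codouble.basis_mul, ite_tmul]
    -- Passing `δ_t` through the form shifts it to `δ_{t s_j}`, so only `t = s s_j⁻¹` meets `δ_s`.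
    rw [Finset.sum_eq_single (s * (j : G)⁻¹)]
    · simp
    · intro b _ hb
      rw [if_neg]
      rintro rfl
      simp at hb
    · simp

/-- The right action fixes `j`, and `δ_t ⊗ v ↦ δ_{t s_j} ⊗ s_j⁻¹ v s_j` is multiplicative. -/
theorem rightMul_mul (ht₀ : t₀ ≠ 1) (ω : (canonicalTangentSpace k t₀).OneForms)
    (a b : Codouble k G) :
    (canonicalTangentSpace k t₀).rightMul (ω ⊗ₜ (a * b)) =
      (canonicalTangentSpace k t₀).rightMul
        ((canonicalTangentSpace k t₀).rightMul (ω ⊗ₜ a) ⊗ₜ b) := by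
  induction ω using basis_induction (oneFormsBasis k ht₀) with
  | h0 => simp
  | hadd x y hx hy => simp only [add_tmul, map_add, hx, hy]
  | hsmul c x hx => simp only [← smul_tmul', map_smul, hx]
  | hb p =>
    obtain ⟨⟨s, u⟩, i, j⟩ := p
    rw [oneFormsBasis_apply]
    induction a using basis_induction (Codouble.basis k G) with
    | h0 => simp
    | hadd x y hx hy => simp only [add_mul, add_tmul, tmul_add, map_add, hx, hy]
    | hsmul c x hx => simp only [smul_mul_assoc, tmul_smul, ← smul_tmul', map_smul, hx]
    | hb q =>
      obtain ⟨t, v⟩ := q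
      induction b using basis_induction (Codouble.basis k G) with
      | h0 => simp
      | hadd x y hx hy => simp only [mul_add, tmul_add, map_add, hx, hy]
      | hsmul c x hx => simp only [mul_smul_comm, tmul_smul, map_smul, hx]
      | hb q' =>
        obtain ⟨t', v'⟩ := q'
        simp only [rightMul_basis, Codouble.basis_mul, mul_assoc]
        by_cases h : t = t'
        · subst h
          by_cases hs : s = t * j <;> simp [rightMul_basis, mul_assoc, Codouble.basis_mul, hs]
        · by_cases hs : s = t * j <;> simp [Codouble.basis_mul, hs, h]

/-- Left multiplication by `δ_s` keeps only the `j`-th term of the first sum in `d_basis`, and kills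
the second sum because `s ≠ s s_j⁻¹`. -/
theorem leftMul_d_basis (ht₀ : t₀ ≠ 1) (s u v : G) (j : ClassG t₀) :
    (canonicalTangentSpace k t₀).leftMul (Codouble.basis k G (s, u) ⊗ₜ
      (canonicalTangentSpace k t₀).d (Codouble.basis k G (s * (j : G)⁻¹, v))) =
      Codouble.basis k G (s, u * ((j : G)⁻¹ * v * j)) ⊗ₜ formBasis k ht₀ (conjBy v⁻¹ j, j) := by
  have h1 : ∀ i : ClassG t₀, s = s * (j : G)⁻¹ * i ↔ i = j := by
    intro i
    rw [mul_assoc, left_eq_mul, inv_mul_eq_one, Subtype.ext_iff, eq_comm]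
  have h2 : s ≠ s * (j : G)⁻¹ := by simpa using coe_ne_one ht₀ j
  simp only [d_basis ht₀, tmul_sub, tmul_sum, map_sub, map_sum, leftMul_tmul, Codouble.basis_mul, h1,
    h2, if_false, zero_tmul, Finset.sum_const_zero, sub_zero, ite_tmul, Finset.sum_ite_eq',
    Finset.mem_univ, if_true]

theorem leftMul_d_surjective (ht₀ : t₀ ≠ 1) :
    Function.Surjective ((canonicalTangentSpace k t₀).leftMul ∘ₗ
      (canonicalTangentSpace k t₀).d.lTensor (Codouble k G)) := by
  rw [← LinearMap.range_eq_top, eq_top_iff, ← (oneFormsBasis k ht₀).span_eq, Submodule.span_le]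
  rintro _ ⟨⟨⟨s, u⟩, i, j⟩, rfl⟩
  obtain ⟨v, hv⟩ := exists_conjBy_eq j i
  -- The differential of the second factor carries `s_j` to `s_i` in the first index of the form;
  -- the extra group element cancels the one it creates on the right.
  refine ⟨Codouble.basis k G (s, u * ((j : G)⁻¹ * v⁻¹ * j)⁻¹) ⊗ₜ
    Codouble.basis k G (s * (j : G)⁻¹, v⁻¹), ?_⟩
  rw [LinearMap.comp_apply, LinearMap.lTensor_tmul, leftMul_d_basis ht₀, oneFormsBasis_apply,
    inv_inv, hv, inv_mul_cancel_right]

theorem isDifferentialCalculus (ht₀ : t₀ ≠ 1) :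
    IsDifferentialCalculus (canonicalTangentSpace k t₀).leftMul
      (canonicalTangentSpace k t₀).rightMul (canonicalTangentSpace k t₀).d where
  one_left ω := by
    induction ω using TensorProduct.induction_on with
    | zero => simp
    | tmul c x => rw [leftMul_tmul, one_mul]
    | add y z hy hz => simp only [tmul_add, map_add, hy, hz]
  mul_left := leftMul_mul _
  one_right := rightMul_one ht₀
  mul_right := rightMul_mul ht₀
  left_right := rightMul_leftMul _
  leibniz a b := by
    simp only [d_eq ht₀, rightMul_mul ht₀, leftMul_mul, tmul_sub, sub_tmul, map_sub,
      rightMul_leftMul]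
    abel
  surjective := leftMul_d_surjective ht₀

/-! ### Bicovariance. -/

theorem leftCoact_form (L : QuantumTangentSpace k G) (x : L.InvForms) :
    L.leftCoact (L.form x) = 1 ⊗ₜ L.form x := by
  simp [QuantumTangentSpace.leftCoact, QuantumTangentSpace.form, Algebra.TensorProduct.one_def]

/-- On the diagonal the label `s_j⁻¹ s_i` is `e`, and conjugation by each `s` permutes the class, so
the coaction reduces to `θ ⊗ ∑ δ_s ⊗ e`. -/
theorem rightCoact_form_theta (ht₀ : t₀ ≠ 1) :
    (canonicalTangentSpace k t₀).rightCoact ((canonicalTangentSpace k t₀).form (theta k ht₀)) =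
      (canonicalTangentSpace k t₀).form (theta k ht₀) ⊗ₜ 1 := by
  have h : (canonicalTangentSpace k t₀).coact (theta k ht₀) =
      theta k ht₀ ⊗ₜ (1 : Codouble k G) := by
    simp only [theta, map_sum, coact_formBasis, inv_mul_cancel, Codouble.one_eq, sum_tmul, tmul_sum]
    rw [Finset.sum_comm]
    refine Finset.sum_congr rfl fun s _ => ?_
    exact Fintype.sum_bijective (conjBy s) ⟨conjBy_injective s, fun i => ⟨conjBy s⁻¹ i, by simp⟩⟩
      _ _ fun _ => rfl
  simp [QuantumTangentSpace.rightCoact, QuantumTangentSpace.form, h,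
    Algebra.TensorProduct.one_def]

theorem coassoc_leftCoact (ht₀ : t₀ ≠ 1) :
    (TensorProduct.assoc k (Codouble k G) (Codouble k G)
      (canonicalTangentSpace k t₀).OneForms).toLinearMap ∘ₗ
      (comul (R := k)).rTensor (canonicalTangentSpace k t₀).OneForms ∘ₗ
      (canonicalTangentSpace k t₀).leftCoact =
      (canonicalTangentSpace k t₀).leftCoact.lTensor (Codouble k G) ∘ₗ
        (canonicalTangentSpace k t₀).leftCoact := by
  refine (oneFormsBasis k ht₀).ext fun ⟨⟨s, u⟩, i, j⟩ => ?_
  simp only [oneFormsBasis_apply, LinearMap.comp_apply, leftCoact_basis, map_sum,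
    LinearMap.rTensor_tmul, comul_basis_mk, sum_tmul, LinearEquiv.coe_coe, assoc_tmul,
    LinearMap.lTensor_tmul, tmul_sum]
  conv_rhs => rw [Finset.sum_comm]
  refine Finset.sum_congr rfl fun r _ => Fintype.sum_equiv (Equiv.mulRight r) _ _ fun a => ?_
  simp [mul_assoc]

theorem counit_leftCoact (L : QuantumTangentSpace k G) (ω : L.OneForms) :
    TensorProduct.lid k L.OneForms
      ((counit (R := k) (A := Codouble k G)).rTensor L.OneForms (L.leftCoact ω)) = ω := by
  induction ω using TensorProduct.induction_on with
  | zero => simp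
  | add y z hy hz => simp only [map_add, hy, hz]
  | tmul a x =>
    induction a using basis_induction (Codouble.basis k G) with
    | h0 => simp
    | hadd x y hx hy => simp only [add_tmul, map_add, hx, hy]
    | hsmul c x hx => simp only [← smul_tmul', map_smul, hx]
    | hb p =>
      obtain ⟨s, u⟩ := p
      simp only [leftCoact_basis, map_sum, LinearMap.rTensor_tmul, Codouble.counit_basis, lid_tmul,
        mul_inv_eq_one]
      simp

theorem coassoc_rightCoact (ht₀ : t₀ ≠ 1) :
    (TensorProduct.assoc k (canonicalTangentSpace k t₀).OneForms (Codouble k G)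
      (Codouble k G)).toLinearMap ∘ₗ
      (canonicalTangentSpace k t₀).rightCoact.rTensor (Codouble k G) ∘ₗ
      (canonicalTangentSpace k t₀).rightCoact =
      (comul (R := k)).lTensor (canonicalTangentSpace k t₀).OneForms ∘ₗ
        (canonicalTangentSpace k t₀).rightCoact := by
  refine (oneFormsBasis k ht₀).ext fun ⟨⟨s, u⟩, i, j⟩ => ?_
  simp only [oneFormsBasis_apply, LinearMap.comp_apply, rightCoact_basis, map_sum,
    LinearMap.rTensor_tmul, comul_basis_mk, sum_tmul, LinearEquiv.coe_coe, assoc_tmul,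
    LinearMap.lTensor_tmul, tmul_sum]
  conv_rhs => rw [Finset.sum_comm]
  refine Finset.sum_congr rfl fun r _ => Fintype.sum_equiv (Equiv.mulRight r) _ _ fun a => ?_
  simp [mul_assoc]

theorem counit_rightCoact (ht₀ : t₀ ≠ 1) (ω : (canonicalTangentSpace k t₀).OneForms) :
    TensorProduct.rid k (canonicalTangentSpace k t₀).OneForms
      ((counit (R := k) (A := Codouble k G)).lTensor (canonicalTangentSpace k t₀).OneForms
        ((canonicalTangentSpace k t₀).rightCoact ω)) = ω := by
  induction ω using basis_induction (oneFormsBasis k ht₀) with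
  | h0 => simp
  | hadd x y hx hy => simp only [map_add, hx, hy]
  | hsmul c x hx => simp only [map_smul, hx]
  | hb p =>
    obtain ⟨⟨s, u⟩, i, j⟩ := p
    simp only [oneFormsBasis_apply, rightCoact_basis, map_sum, LinearMap.lTensor_tmul,
      Codouble.counit_basis, rid_tmul]
    simp

theorem leftCoact_rightCoact_comm (ht₀ : t₀ ≠ 1) :
    (TensorProduct.assoc k (Codouble k G) (canonicalTangentSpace k t₀).OneForms
      (Codouble k G)).toLinearMap ∘ₗ
      (canonicalTangentSpace k t₀).leftCoact.rTensor (Codouble k G) ∘ₗ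
      (canonicalTangentSpace k t₀).rightCoact =
      (canonicalTangentSpace k t₀).rightCoact.lTensor (Codouble k G) ∘ₗ
        (canonicalTangentSpace k t₀).leftCoact := by
  refine (oneFormsBasis k ht₀).ext fun ⟨⟨s, u⟩, i, j⟩ => ?_
  simp only [oneFormsBasis_apply, LinearMap.comp_apply, rightCoact_basis, leftCoact_basis, map_sum,
    LinearMap.rTensor_tmul, sum_tmul, LinearEquiv.coe_coe, assoc_tmul,
    LinearMap.lTensor_tmul, tmul_sum]
  conv_rhs => rw [Finset.sum_comm]
  refine Finset.sum_congr rfl fun r _ => Fintype.sum_equiv (Equiv.mulRight r) _ _ fun a => ?_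
  simp [mul_assoc]

theorem leftCoact_leftMul (ht₀ : t₀ ≠ 1) :
    (canonicalTangentSpace k t₀).leftCoact ∘ₗ (canonicalTangentSpace k t₀).leftMul =
      map (LinearMap.mul' k (Codouble k G)) (canonicalTangentSpace k t₀).leftMul ∘ₗ
      (tensorTensorTensorComm k (Codouble k G) (Codouble k G) (Codouble k G)
        (canonicalTangentSpace k t₀).OneForms).toLinearMap ∘ₗ
      map (comul (R := k)) (canonicalTangentSpace k t₀).leftCoact := by
  refine ((Codouble.basis k G).tensorProduct (oneFormsBasis k ht₀)).ext
    fun ⟨⟨t, v⟩, ⟨s, u⟩, i, j⟩ => ?_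
  simp only [Module.Basis.tensorProduct_apply, oneFormsBasis_apply, LinearMap.comp_apply,
    leftCoact_basis, map_sum, leftMul_tmul, comul_basis_mk, sum_tmul, LinearEquiv.coe_coe,
    tmul_sum, map_tmul, tensorTensorTensorComm_tmul, LinearMap.mul'_apply, Codouble.basis_mul,
    ite_tmul, tmul_ite, Finset.sum_ite_eq', Finset.mem_univ, if_true, mul_left_inj]
  split_ifs with h
  · simp only [leftCoact_basis]
    refine Finset.sum_congr rfl fun r _ => ?_
    simp [mul_assoc]
  · simp

theorem leftCoact_rightMul (ht₀ : t₀ ≠ 1) :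
    (canonicalTangentSpace k t₀).leftCoact ∘ₗ (canonicalTangentSpace k t₀).rightMul =
      map (LinearMap.mul' k (Codouble k G)) (canonicalTangentSpace k t₀).rightMul ∘ₗ
      (tensorTensorTensorComm k (Codouble k G) (canonicalTangentSpace k t₀).OneForms (Codouble k G)
        (Codouble k G)).toLinearMap ∘ₗ
      map (canonicalTangentSpace k t₀).leftCoact (comul (R := k)) := by
  refine ((oneFormsBasis k ht₀).tensorProduct (Codouble.basis k G)).ext
    fun ⟨⟨⟨s, u⟩, i, j⟩, t, v⟩ => ?_
  simp only [Module.Basis.tensorProduct_apply, oneFormsBasis_apply, LinearMap.comp_apply,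
    leftCoact_basis, map_sum, rightMul_basis, comul_basis_mk, sum_tmul, LinearEquiv.coe_coe,
    tmul_sum, map_tmul, tensorTensorTensorComm_tmul, LinearMap.mul'_apply, Codouble.basis_mul,
    ite_tmul, tmul_ite, Finset.sum_ite_eq', Finset.mem_univ, if_true]
  -- Non-vanishing of each summand is the same condition as before coacting; the shift by `s_j` is
  -- then absorbed by reindexing.
  have h : ∀ x : G, s * (x * (j : G))⁻¹ = t * x⁻¹ ↔ s = t * j := fun x => by
    rw [mul_inv_rev, ← mul_assoc, mul_left_inj, mul_inv_eq_iff_eq_mul]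
  simp only [h]
  split_ifs with hs
  · simp only [leftCoact_basis]
    refine Fintype.sum_equiv (Equiv.mulRight (j : G)⁻¹) _ _ fun r => ?_
    simp [mul_assoc]
  · simp

theorem rightCoact_leftMul (ht₀ : t₀ ≠ 1) :
    (canonicalTangentSpace k t₀).rightCoact ∘ₗ (canonicalTangentSpace k t₀).leftMul =
      map (canonicalTangentSpace k t₀).leftMul (LinearMap.mul' k (Codouble k G)) ∘ₗ
      (tensorTensorTensorComm k (Codouble k G) (Codouble k G) (canonicalTangentSpace k t₀).OneForms
        (Codouble k G)).toLinearMap ∘ₗ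
      map (comul (R := k)) (canonicalTangentSpace k t₀).rightCoact := by
  refine ((Codouble.basis k G).tensorProduct (oneFormsBasis k ht₀)).ext
    fun ⟨⟨t, v⟩, ⟨s, u⟩, i, j⟩ => ?_
  simp only [Module.Basis.tensorProduct_apply, oneFormsBasis_apply, LinearMap.comp_apply,
    rightCoact_basis, map_sum, leftMul_tmul, comul_basis_mk, sum_tmul, LinearEquiv.coe_coe,
    tmul_sum, map_tmul, tensorTensorTensorComm_tmul, LinearMap.mul'_apply, Codouble.basis_mul,
    ite_tmul, tmul_ite, Finset.sum_ite_eq', Finset.mem_univ, if_true]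
  simp only [mul_left_inj]
  split_ifs with hs
  · simp only [rightCoact_basis]
    refine Finset.sum_congr rfl fun r _ => ?_
    simp [mul_assoc]
  · simp

theorem rightCoact_rightMul (ht₀ : t₀ ≠ 1) :
    (canonicalTangentSpace k t₀).rightCoact ∘ₗ (canonicalTangentSpace k t₀).rightMul =
      map (canonicalTangentSpace k t₀).rightMul (LinearMap.mul' k (Codouble k G)) ∘ₗ
      (tensorTensorTensorComm k (canonicalTangentSpace k t₀).OneForms (Codouble k G) (Codouble k G)
        (Codouble k G)).toLinearMap ∘ₗ
      map (canonicalTangentSpace k t₀).rightCoact (comul (R := k)) := by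
  refine ((oneFormsBasis k ht₀).tensorProduct (Codouble.basis k G)).ext
    fun ⟨⟨⟨s, u⟩, i, j⟩, t, v⟩ => ?_
  simp only [Module.Basis.tensorProduct_apply, oneFormsBasis_apply, LinearMap.comp_apply,
    rightCoact_basis, map_sum, rightMul_basis, comul_basis_mk, sum_tmul, LinearEquiv.coe_coe,
    tmul_sum, map_tmul, tensorTensorTensorComm_tmul, LinearMap.mul'_apply, Codouble.basis_mul,
    ite_tmul, tmul_ite, Finset.sum_ite_eq', Finset.mem_univ, if_true]
  -- The coaction conjugates `s_j` by `x`, which is what makes the condition independent of `x`.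
  have h : ∀ x : G, s * x⁻¹ = t * x⁻¹ * (conjBy x j : G) ↔ s = t * j := fun x => by
    rw [coe_conjBy, ← mul_assoc, ← mul_assoc, inv_mul_cancel_right, mul_left_inj]
  simp only [h]
  split_ifs with hs
  · simp only [rightCoact_basis]
    refine Finset.sum_congr rfl fun r _ => ?_
    simp [mul_assoc]
  · simp

/-- Since `d a = θ a - a θ`, with both multiplications compatible with the coaction and `θ ↦ 1 ⊗ θ`,
applying the coaction gives the same commutator in the second leg of `Δ a`. -/
theorem leftCoact_d (ht₀ : t₀ ≠ 1) :
    (canonicalTangentSpace k t₀).leftCoact ∘ₗ (canonicalTangentSpace k t₀).d =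
      (canonicalTangentSpace k t₀).d.lTensor (Codouble k G) ∘ₗ comul (R := k) := by
  ext1 a
  have h1 := LinearMap.congr_fun (leftCoact_rightMul (k := k) ht₀)
    ((canonicalTangentSpace k t₀).form (theta k ht₀) ⊗ₜ a)
  have h2 := LinearMap.congr_fun (leftCoact_leftMul (k := k) ht₀)
    (a ⊗ₜ (canonicalTangentSpace k t₀).form (theta k ht₀))
  simp only [LinearMap.comp_apply, map_tmul, leftCoact_form] at h1 h2 ⊢
  rw [d_eq ht₀, map_sub, h1, h2]
  induction comul (R := k) a using TensorProduct.induction_on with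
  | zero => simp
  | tmul b c => simp [tensorTensorTensorComm_tmul, d_eq ht₀, tmul_sub]
  | add y z hy hz =>
    simp only [tmul_add, add_tmul, map_add, ← hy, ← hz]
    abel

theorem rightCoact_d (ht₀ : t₀ ≠ 1) :
    (canonicalTangentSpace k t₀).rightCoact ∘ₗ (canonicalTangentSpace k t₀).d =
      (canonicalTangentSpace k t₀).d.rTensor (Codouble k G) ∘ₗ comul (R := k) := by
  ext1 a
  have h1 := LinearMap.congr_fun (rightCoact_rightMul (k := k) ht₀)
    ((canonicalTangentSpace k t₀).form (theta k ht₀) ⊗ₜ a)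
  have h2 := LinearMap.congr_fun (rightCoact_leftMul (k := k) ht₀)
    (a ⊗ₜ (canonicalTangentSpace k t₀).form (theta k ht₀))
  simp only [LinearMap.comp_apply, map_tmul, rightCoact_form_theta] at h1 h2 ⊢
  rw [d_eq ht₀, map_sub, h1, h2]
  induction comul (R := k) a using TensorProduct.induction_on with
  | zero => simp
  | tmul b c => simp [tensorTensorTensorComm_tmul, d_eq ht₀, sub_tmul]
  | add y z hy hz =>
    simp only [tmul_add, add_tmul, map_add, ← hy, ← hz]
    abel

theorem isBicovariantCalculus (ht₀ : t₀ ≠ 1) :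
    IsBicovariantCalculus (canonicalTangentSpace k t₀).leftMul
      (canonicalTangentSpace k t₀).rightMul (canonicalTangentSpace k t₀).d
      (canonicalTangentSpace k t₀).leftCoact (canonicalTangentSpace k t₀).rightCoact where
  toIsDifferentialCalculus := isDifferentialCalculus ht₀
  coassoc_left := coassoc_leftCoact ht₀
  counit_left := counit_leftCoact _
  coassoc_right := coassoc_rightCoact ht₀
  counit_right := counit_rightCoact ht₀
  left_right_comm := leftCoact_rightCoact_comm ht₀
  left_coact_left_mul := leftCoact_leftMul ht₀
  left_coact_right_mul := leftCoact_rightMul ht₀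
  right_coact_left_mul := rightCoact_leftMul ht₀
  right_coact_right_mul := rightCoact_rightMul ht₀
  left_coact_d := leftCoact_d ht₀
  right_coact_d := rightCoact_d ht₀

/-! ### Irreducibility. -/

/-- Transitivity: the adjoint action brings the second index to its target, and the coregular action
then moves the first while fixing the second. -/
theorem tangentVector_mem_of_mem {L : QuantumTangentSpace k G} {p : ClassG t₀ × ClassG t₀}
    (hp : tangentVector k p ∈ L.carrier) (q : ClassG t₀ × ClassG t₀) :
    tangentVector k q ∈ L.carrier := by
  obtain ⟨i, j⟩ := p
  obtain ⟨l, m⟩ := q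
  obtain ⟨s, rfl⟩ := exists_conjBy_eq j m
  have h1 := L.adjoint_mem
    (Double.basis k G (s⁻¹, s⁻¹⁻¹ * (j : G)⁻¹ * i * s⁻¹)) _ hp
  rw [adjoint_tangentVector, if_pos rfl, inv_inv] at h1
  obtain ⟨u, rfl⟩ := exists_conjBy_eq (conjBy s i) l
  have h2 := L.coregular_mem (Codouble.basis k G ((conjBy s j : G)⁻¹, u)) _ h1
  rwa [coregular_tangentVector, if_pos rfl] at h2

/-- `δ_{s_m⁻¹} ⊗ e` projects onto second index `m`, and `e ⊗ δ_{s_m⁻¹ s_l}` then selects first index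
`l`; together they extract one term of the sum. -/
theorem tangentVector_mem_of_sum_mem {L : QuantumTangentSpace k G}
    (c : ClassG t₀ × ClassG t₀ → k) (hc : ∑ p, c p • tangentVector k p ∈ L.carrier)
    {q : ClassG t₀ × ClassG t₀} (hq : c q ≠ 0) : tangentVector k q ∈ L.carrier := by
  obtain ⟨l, m⟩ := q
  have h := L.adjoint_mem (Double.basis k G (1, (m : G)⁻¹ * l)) _
    (L.coregular_mem (Codouble.basis k G ((m : G)⁻¹, 1)) _ hc)
  have hterm : ∀ p : ClassG t₀ × ClassG t₀,
      adjoint k G (Double.basis k G (1, (m : G)⁻¹ * l))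
        (coregular k G (Codouble.basis k G ((m : G)⁻¹, 1)) (c p • tangentVector k p)) =
      if p = (l, m) then c (l, m) • tangentVector k (l, m) else 0 := by
    rintro ⟨i, j⟩
    rw [map_smul, map_smul, coregular_tangentVector]
    by_cases hj : j = m
    · subst hj
      rw [if_pos rfl, adjoint_tangentVector]
      by_cases hi : i = l
      · simp [hi]
      · have : (l : G) ≠ i := fun h => hi (Subtype.ext h.symm)
        simp [hi, this]
    · have : (m : G) ≠ j := fun h => hj (Subtype.ext h.symm)
      simp [hj, this]
  rw [map_sum, map_sum, Finset.sum_congr rfl fun p _ => hterm p, Finset.sum_ite_eq'] at h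
  simp only [Finset.mem_univ, if_true] at h
  exact (Submodule.smul_mem_iff _ hq).mp h

theorem isIrreducible (ht₀ : t₀ ≠ 1) : (canonicalTangentSpace k t₀).IsIrreducible := by
  have i₀ : ClassG t₀ := ⟨t₀⁻¹, IsConj.refl _⟩
  refine ⟨fun h => ?_, fun L hL => or_iff_not_imp_left.mpr fun hne => le_antisymm hL ?_⟩
  · refine (linearIndependent_tangentVector (k := k) ht₀).ne_zero (i₀, i₀) ?_
    rw [← Submodule.mem_bot k, ← h]
    exact Submodule.subset_span ⟨_, rfl⟩
  · obtain ⟨l, hl, hl0⟩ := Submodule.exists_mem_ne_zero_of_ne_bot hne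
    have hsum : l = ∑ p, (tangentBasis k ht₀).repr ⟨l, hL hl⟩ p • tangentVector k p := by
      have := congrArg Subtype.val ((tangentBasis k ht₀).sum_repr ⟨l, hL hl⟩)
      simpa only [AddSubmonoidClass.coe_finsetSum, Submodule.coe_smul, coe_tangentBasis]
        using this.symm
    obtain ⟨q, hq⟩ : ∃ q, (tangentBasis k ht₀).repr ⟨l, hL hl⟩ q ≠ 0 := by
      by_contra! h
      apply hl0
      rw [hsum]
      simp [h]
    refine Submodule.span_le.mpr ?_
    rintro _ ⟨p, rfl⟩
    exact tangentVector_mem_of_mem (tangentVector_mem_of_sum_mem _ (hsum ▸ hl) hq) p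

/-! ### Commutation relations, differentials and braiding. -/

theorem rightMul_form_ofFun (ht₀ : t₀ ≠ 1) (i j : ClassG t₀) (φ : G → k) :
    (canonicalTangentSpace k t₀).rightMul
      ((canonicalTangentSpace k t₀).form (formBasis k ht₀ (i, j)) ⊗ₜ Codouble.ofFun k G φ) =
      (canonicalTangentSpace k t₀).leftMul (Codouble.ofFun k G (translate (j : G) φ) ⊗ₜ
        (canonicalTangentSpace k t₀).form (formBasis k ht₀ (i, j))) := by
  rw [leftMul_form]
  simp only [QuantumTangentSpace.form, Codouble.ofFun, tmul_sum, tmul_smul, map_sum, map_smul,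
    rightMul_basis, one_mul, sum_tmul, ← smul_tmul']
  refine Fintype.sum_equiv (Equiv.mulRight (j : G)) _ _ fun t => ?_
  simp [translate]

theorem rightMul_form_ofGroup (ht₀ : t₀ ≠ 1) (i j : ClassG t₀) (u : G) :
    (canonicalTangentSpace k t₀).rightMul
      ((canonicalTangentSpace k t₀).form (formBasis k ht₀ (i, j)) ⊗ₜ Codouble.ofGroup k G u) =
      (canonicalTangentSpace k t₀).leftMul (Codouble.ofGroup k G ((j : G)⁻¹ * u * j) ⊗ₜ
        (canonicalTangentSpace k t₀).form (formBasis k ht₀ (conjBy u⁻¹ i, j))) := by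
  rw [leftMul_form]
  simp only [QuantumTangentSpace.form, Codouble.ofGroup, tmul_sum, map_sum,
    rightMul_basis, one_mul, sum_tmul]
  exact Fintype.sum_equiv (Equiv.mulRight (j : G)) _ _ fun t => rfl

theorem d_ofFun (ht₀ : t₀ ≠ 1) (φ : G → k) :
    (canonicalTangentSpace k t₀).d (Codouble.ofFun k G φ) =
      ∑ i : ClassG t₀, (canonicalTangentSpace k t₀).leftMul
        (Codouble.ofFun k G (translate (i : G) φ - φ) ⊗ₜ
          (canonicalTangentSpace k t₀).form (formBasis k ht₀ (i, i))) := by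
  have h : ∀ f g : G → k,
      Codouble.ofFun k G (f - g) = Codouble.ofFun k G f - Codouble.ofFun k G g := fun f g => by
    simp [Codouble.ofFun, sub_smul]
  rw [d_eq ht₀, theta, form_sum, sum_tmul, map_sum, tmul_sum, map_sum, ← Finset.sum_sub_distrib]
  simp only [rightMul_form_ofFun, h, sub_tmul, map_sub]

theorem d_ofGroup (ht₀ : t₀ ≠ 1) (u : G) :
    (canonicalTangentSpace k t₀).d (Codouble.ofGroup k G u) =
      ∑ i : ClassG t₀, (canonicalTangentSpace k t₀).leftMul
        (Codouble.ofGroup k G ((i : G)⁻¹ * u * i) ⊗ₜ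
          (canonicalTangentSpace k t₀).form (formBasis k ht₀ (conjBy u⁻¹ i, i))) -
      ∑ i : ClassG t₀, (canonicalTangentSpace k t₀).leftMul (Codouble.ofGroup k G u ⊗ₜ
        (canonicalTangentSpace k t₀).form (formBasis k ht₀ (i, i))) := by
  rw [d_eq ht₀, theta, form_sum, sum_tmul, map_sum, tmul_sum, map_sum]
  simp only [rightMul_form_ofGroup]

/-- Only one pair of dual basis vectors contributes: the right action forces `s = s_j⁻¹` and the
left action forces `u = s_m⁻¹ s_l`. -/
theorem braiding_formBasis (ht₀ : t₀ ≠ 1) (i j l m : ClassG t₀) :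
    (canonicalTangentSpace k t₀).braiding (formBasis k ht₀ (i, j) ⊗ₜ formBasis k ht₀ (l, m)) =
      formBasis k ht₀ (conjBy (j : G)⁻¹ l, conjBy (j : G)⁻¹ m) ⊗ₜ
        formBasis k ht₀ (conjBy ((m : G)⁻¹ * l)⁻¹ i, j) := by
  simp only [QuantumTangentSpace.braiding, LinearMap.sum_apply, LinearMap.comp_apply,
    Fintype.sum_prod_type, LinearEquiv.coe_coe, comm_tmul, map_tmul, leftAct_formBasis,
    LinearMap.flip_apply, rightAct_formBasis, ite_tmul, tmul_ite]
  rw [Finset.sum_comm]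
  simp only [Finset.sum_ite_eq', Finset.mem_univ, if_true]

end CanonicalCalculus
end QuantumCodouble

end

theorem mainTheorem7 {k G : Type*} [Field k] [CharZero k] [Group G] [Fintype G] [DecidableEq G]
    (t₀ : G) (ht₀ : t₀ ≠ 1) (sbar : ClassG t₀ → G)
    (hsbar : ∀ i : ClassG t₀, (sbar i)⁻¹ * t₀⁻¹ * sbar i = i) :
    Function.Bijective (fun p : ClassG t₀ × ClassG t₀ => z p.1 p.2) ∧
    ∃ (L : QuantumTangentSpace k G) (f : Module.Basis (ClassX t₀) k L.carrier)
      (e : Module.Basis (ClassX t₀) k L.InvForms),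
      -- the canonical quantum tangent space, its basis `f`, and the dual basis `e`
      L.carrier = (tangentModule k sbar).map (toTangent k) ∧
      (∀ i j, (f (z i j) : Double k G) =
        toTangent k (crossedAct k (zbar sbar i j) (m₀ k t₀))) ∧
      (∀ w w', e w (f w') = if w = w' then 1 else 0) ∧
      -- it defines an irreducible bicovariant calculus of dimension `|C|²`
      IsBicovariantCalculus L.leftMul L.rightMul L.d L.leftCoact L.rightCoact ∧
      L.IsIrreducible ∧
      Module.finrank k L.InvForms = Nat.card (ClassG t₀) ^ 2 ∧
      -- commutation relations
      (∀ i j (φ : G → k), L.rightMul (L.form (e (z i j)) ⊗ₜ Codouble.ofFun k G φ) =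
        L.leftMul (Codouble.ofFun k G (translate (j : G) φ) ⊗ₜ L.form (e (z i j)))) ∧
      (∀ i j (u : G), L.rightMul (L.form (e (z i j)) ⊗ₜ Codouble.ofGroup k G u) =
        L.leftMul (Codouble.ofGroup k G ((j : G)⁻¹ * u * j) ⊗ₜ
          L.form (e (conj (z i j) (SemidirectProduct.inl u))))) ∧
      -- differentials
      (∀ φ : G → k, L.d (Codouble.ofFun k G φ) =
        ∑ i : ClassG t₀, L.leftMul (Codouble.ofFun k G (translate (i : G) φ - φ) ⊗ₜ L.form (e (z i i)))) ∧
      (∀ u : G, L.d (Codouble.ofGroup k G u) =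
        ∑ i : ClassG t₀, L.leftMul (Codouble.ofGroup k G ((i : G)⁻¹ * u * i) ⊗ₜ
          L.form (e (conj (z i i) (SemidirectProduct.inl u)))) -
        ∑ i : ClassG t₀, L.leftMul (Codouble.ofGroup k G u ⊗ₜ L.form (e (z i i)))) ∧
      -- the calculus is inner
      (∀ a : Codouble k G, L.d a =
        L.rightMul (L.form (∑ i : ClassG t₀, e (z i i)) ⊗ₜ a) -
        L.leftMul (a ⊗ₜ L.form (∑ i : ClassG t₀, e (z i i)))) ∧
      -- braiding
      (∀ i j l m : ClassG t₀, L.braiding (e (z i j) ⊗ₜ e (z l m)) =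
        e (conj (z l m) (SemidirectProduct.inr (j : G))) ⊗ₜ
        e (conj (z i j) (SemidirectProduct.inl ((m : G)⁻¹ * l)))) := by
  -- The bases constructed so far are indexed by pairs; `E` transports them to the class in `X`.
  let E : ClassG t₀ × ClassG t₀ ≃ ClassX t₀ := Equiv.ofBijective _ z_bijective
  have hE : ∀ i j, E.symm (z i j) = (i, j) := fun i j => E.symm_apply_apply (i, j)
  have he : ∀ i j, (formBasis k ht₀).reindex E (z i j) = formBasis k ht₀ (i, j) := fun i j => by
    rw [Module.Basis.reindex_apply, hE]
  refine ⟨z_bijective, canonicalTangentSpace k t₀, (tangentBasis k ht₀).reindex E,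
    (formBasis k ht₀).reindex E, (map_toTangent_tangentModule sbar hsbar).symm, ?_, ?_,
    isBicovariantCalculus ht₀, isIrreducible ht₀, ?_, ?_, ?_, ?_, ?_, ?_, ?_⟩
  · intro i j
    rw [Module.Basis.reindex_apply, hE, coe_tangentBasis, toTangent_crossedAct_m₀ sbar hsbar]
  · intro w w'
    simp [Module.Basis.reindex_apply, formBasis_apply]
  · rw [Module.finrank_eq_card_basis (formBasis k ht₀), Fintype.card_prod, Nat.card_eq_fintype_card,
      sq]
  · intro i j φ
    rw [he, rightMul_form_ofFun]
  · intro i j u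
    rw [conj_z_inl, he, he, rightMul_form_ofGroup]
  · intro φ
    simp only [he, d_ofFun ht₀]
  · intro u
    simp only [conj_z_inl, he, d_ofGroup ht₀]
  · intro a
    simp only [he]
    exact d_eq ht₀ a
  · intro i j l m
    simp only [conj_z_inl, conj_z_inr, he, braiding_formBasis]
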